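/- Let $r>0$ and let $X$ be a standard Brownian motion started at $0$ and reset to $0$ at the jump times of an independent Poisson process $N$ of intensity $r$; that is, $X(t)=B(t)-B(\tau_{N(t)})$, $t\ge 0$, where $B$ is a standard Brownian motion independent of $N$, $\tau_k$ is the time of the $k$-th jump of $N$ and $\tau_0=0$. Let $$L_r=\sup\{t\in[0,1] : X(t)=0\}$$ be the last zero of $X$ in $[0,1]$, and let $\gamma(s,x)=\int_0^x u^{s-1}e^{-u}\,du$ be the lower incomplete gamma function. Then $L_r$ has an absolutely continuous law, concentrated on $(0,1)$, with probability density $$p_{L_r}(t)=\frac{e^{-r}}{\pi\sqrt{t(1-t)}}+\frac{\sqrt r\,e^{r(t-1)}}{\pi\sqrt{1-t}}\,\gamma\!\left(\tfrac12,rt\right),\qquad 0<t<1 .$$ Equivalently, the law of $L_r$ is a mixture of two probability laws: for $0<t<1$, $$p_{L_r}(t)=e^{-r}\,p_L(t)+(1-e^{-r})\,p_X(r;t),$$ where $$p_L(t)=\frac1{\pi\sqrt{t(1-t)}},\qquad p_X(r;t)=\frac{\sqrt r}{\pi(e^{r}-1)}\,\frac{e^{rt}}{\sqrt{1-t}}\,\gamma\!\left(\tfrac12,rt\right)$$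 are both probability densities on $(0,1)$, the first being the density of the arcsine law. -/

import Mathlib

open MeasureTheory ProbabilityTheory Set
open scoped ENNReal NNReal

noncomputable section

namespace ResetBM

/-- `N` is a Poisson process of intensity `r` under `P`: a counting process (almost all paths are
nondecreasing, right-continuous and `ℕ`-valued) started at `0`, with independent and stationary
increments, whose value at time `t` is Poisson distributed with mean `r * t`. -/
structure IsPoissonProcess {Ω : Type*} [MeasurableSpace Ω] (N : ℝ≥0 → Ω → ℕ) (r : ℝ≥0)
    (P : Measure Ω) : Prop where
  monotone : ∀ᵐ ω ∂P, Monotone (fun t => N t ω)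
  rightCont : ∀ᵐ ω ∂P, ∀ t : ℝ≥0, ContinuousWithinAt (fun s => N s ω) (Ici t) t
  zero : ∀ᵐ ω ∂P, N 0 ω = 0
  indepIncrements : HasIndepIncrements (fun t ω => (N t ω : ℤ)) P
  stationary : ∀ s t : ℝ≥0,
    IdentDistrib (fun ω => (N (s + t) ω : ℤ) - (N s ω : ℤ)) (fun ω => (N t ω : ℤ) - (N 0 ω : ℤ)) P P
  law : ∀ t : ℝ≥0, HasLaw (N t) (poissonMeasure (r * t)) P

/-- The time `τ_k` of the `k`-th jump of a counting path `n`; `τ_0 = 0`. -/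
def jumpTime (n : ℝ≥0 → ℕ) (k : ℕ) : ℝ≥0 := sInf {s : ℝ≥0 | k ≤ n s}

/-- The path `b` reset to `0` at every jump of the counting path `n`: the time of the last reset
up to time `t` is `τ_{n t}` (or `0` if there was none), and since then the resetted path has
started afresh from `0` and followed the increments of `b`. -/
def resetPath (b : ℝ≥0 → ℝ) (n : ℝ≥0 → ℕ) (t : ℝ≥0) : ℝ := b t - b (jumpTime n (n t))

/-- `X` is a standard Brownian motion started at `0` under Poissonian resetting to `0` with
intensity `r`: it follows the increments of a Brownian motion `B` and is put back to `0` at the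
jump times of a Poisson process `N` of intensity `r` which is independent of `B`. (Given `N`, the
pieces of `X` between consecutive resets are independent Brownian motions started at `0`.) -/
def IsResetBrownian {Ω : Type*} [MeasurableSpace Ω] (X : ℝ≥0 → Ω → ℝ) (r : ℝ≥0)
    (P : Measure Ω) : Prop :=
  ∃ (B : ℝ≥0 → Ω → ℝ) (N : ℝ≥0 → Ω → ℕ),
    IsBrownianReal B P ∧ IsPoissonProcess N r P ∧
    IndepFun (fun ω t => B t ω) (fun ω t => N t ω) P ∧
    ∀ᵐ ω ∂P, ∀ t : ℝ≥0, X t ω = resetPath (fun s => B s ω) (fun s => N s ω) t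

/-- The last zero in `[0,1]` of a path, `sup {t ∈ [0,1] : x t = 0}`. -/
def lastZero (x : ℝ≥0 → ℝ) : ℝ := ((sSup {t : ℝ≥0 | t ≤ 1 ∧ x t = 0} : ℝ≥0) : ℝ)

/-- The lower incomplete gamma function `γ(s, x) = ∫_0^x u^(s-1) e^(-u) du`. -/
def lowerGamma (s x : ℝ) : ℝ := ∫ u in (0 : ℝ)..x, u ^ (s - 1) * Real.exp (-u)

/-- The measure on `ℝ` concentrated on `(0,1)` with density `p` there. -/
def lawOfDensity (p : ℝ → ℝ) : Measure ℝ :=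
  (volume.restrict (Ioo (0 : ℝ) 1)).withDensity (fun t => ENNReal.ofReal (p t))

/-- The density of the arcsine law on `(0,1)`. -/
def arcsinePDF (t : ℝ) : ℝ := 1 / (Real.pi * √(t * (1 - t)))

/-- The density, on `(0,1)`, of the last zero of reset Brownian motion. -/
def lastZeroPDF (r t : ℝ) : ℝ :=
  Real.exp (-r) / (Real.pi * √(t * (1 - t))) +
    √r * Real.exp (r * (t - 1)) * lowerGamma (1 / 2) (r * t) / (Real.pi * √(1 - t))

/-- The second component of the mixture, on `(0,1)`. -/
def resetPDF (r t : ℝ) : ℝ :=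
  √r / (Real.pi * (Real.exp r - 1)) * (Real.exp (r * t) / √(1 - t)) * lowerGamma (1 / 2) (r * t)

end ResetBM

end

open Filter Topology

namespace ResetBM


/-! ### Paths -/

section Paths

/-! Let τ be the last reset before time 1. On [τ, 1] the reset path is B - B(τ), so its last zero
lies before t iff τ < t and B does not return to B(τ) during [t, 1] (`lastZero_resetPath_lt_iff`).
As τ depends only on N, it is independent of B: given τ = s, the last zero has the arcsine law on
(s, 1) (`measure_not_exists_return`). The law of τ is e^{-r}δ₀ + r e^{-r(1-s)} ds
(`hasLaw_lastReset`). Tonelli mixes the two: the atom gives the arcsine term, the continuous part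
the incomplete gamma term.

The arcsine law comes from a sign correlation instead of hitting-time densities. Just after the
first zero in [a, c], the remaining increment is symmetric and independent of the past, so sign W(a)
· sign W(c) averages to 0 on the event of a zero. Off that event the product is 1. Hence P(no zero
in [a, c]) = E[sign W(a) sign W(c)], a Gaussian integral equal to (2/π) arctan √(a/(c-a)). The first
zero is handled on finite grids, where independence of increments replaces the strong Markov
property. -/

lemma exists_apply_eq_iff_dense {x : ℝ≥0 → ℝ} (hx : Continuous x) {q : ℕ → ℝ≥0}
    (hq : DenseRange q) {a c : ℝ≥0} (hac : a < c) (y : ℝ) :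
    (∃ u ∈ Icc a c, x u = y) ↔
      ∀ m : ℕ, ∃ i, q i ∈ Icc a c ∧ |x (q i) - y| < 1 / ((m : ℝ) + 1) := by
  constructor
  · rintro ⟨u, hu, rfl⟩ m
    have hpos : (0 : ℝ) < 1 / ((m : ℝ) + 1) := by positivity
    have hopen : IsOpen {v | |x v - x u| < 1 / ((m : ℝ) + 1)} :=
      isOpen_lt (by fun_prop) continuous_const
    have hmem : u ∈ closure (Ioo a c) := by rwa [closure_Ioo hac.ne]
    obtain ⟨v, hv1, hv2⟩ := mem_closure_iff.1 hmem _ hopen (by simpa using hpos)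
    obtain ⟨i, hi⟩ := hq.exists_mem_open (hopen.inter isOpen_Ioo) ⟨v, hv1, hv2⟩
    exact ⟨i, Ioo_subset_Icc_self hi.2, hi.1⟩
  · intro h
    obtain ⟨u, hu, hmin⟩ := isCompact_Icc.exists_isMinOn (nonempty_Icc.2 hac.le)
      (f := fun v => |x v - y|) (by fun_prop)
    refine ⟨u, hu, ?_⟩
    by_contra hne
    have hpos : 0 < |x u - y| := abs_pos.2 (sub_ne_zero.2 hne)
    obtain ⟨m, hm⟩ := exists_nat_one_div_lt hpos
    obtain ⟨i, hi, hlt⟩ := h m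
    exact absurd (hmin hi) (not_le.2 (hlt.trans hm))

/-- The level x(s) is itself approximated by values x(q j) with q j near s. The condition thus
becomes jointly measurable in s and in the values on the dense sequence, as needed when s is random.
-/
lemma exists_apply_eq_apply_iff_dense {x : ℝ≥0 → ℝ} (hx : Continuous x) {q : ℕ → ℝ≥0}
    (hq : DenseRange q) {a c : ℝ≥0} (hac : a < c) (s : ℝ≥0) :
    (∃ u ∈ Icc a c, x u = x s) ↔
      ∀ m : ℕ, ∃ i j, q i ∈ Icc a c ∧ dist (q j) s < 1 / ((m : ℝ) + 1) ∧
        |x (q i) - x (q j)| < 1 / ((m : ℝ) + 1) := by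
  constructor
  · rintro h m
    have hpos : (0 : ℝ) < 1 / ((m : ℝ) + 1) := by positivity
    obtain ⟨m', hm'⟩ := exists_nat_one_div_lt (half_pos hpos)
    obtain ⟨i, hi, hlt⟩ := (exists_apply_eq_iff_dense hx hq hac (x s)).1 h m'
    have hopen : IsOpen {v | dist v s < 1 / ((m : ℝ) + 1) ∧
        |x v - x s| < 1 / ((m : ℝ) + 1) / 2} :=
      IsOpen.and (isOpen_lt (by fun_prop) continuous_const)
        (isOpen_lt (by fun_prop) continuous_const)
    obtain ⟨j, hj1, hj2⟩ := hq.exists_mem_open hopen ⟨s, by simpa using hpos, by simpa using hpos⟩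
    refine ⟨i, j, hi, hj1, ?_⟩
    have := abs_sub_le (x (q i)) (x s) (x (q j))
    rw [abs_sub_comm (x s)] at this
    linarith
  · intro h
    choose i j hi hj hij using h
    obtain ⟨u, hu, φ, hφ, hlim⟩ := isCompact_Icc.tendsto_subseq hi
    refine ⟨u, hu, ?_⟩
    have hz : Tendsto (fun m : ℕ => 1 / ((φ m : ℝ) + 1)) atTop (𝓝 0) :=
      tendsto_one_div_add_atTop_nhds_zero_nat.comp hφ.tendsto_atTop
    have hjs : Tendsto (fun m => q (j (φ m))) atTop (𝓝 s) :=
      tendsto_iff_dist_tendsto_zero.2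
        (squeeze_zero (fun _ => dist_nonneg) (fun m => (hj (φ m)).le) hz)
    have h1 : Tendsto (fun m => |x (q (i (φ m))) - x (q (j (φ m)))|) atTop (𝓝 |x u - x s|) :=
      (((hx.tendsto u).comp hlim).sub ((hx.tendsto s).comp hjs)).abs
    have h2 := squeeze_zero (fun m => abs_nonneg _) (fun m => (hij (φ m)).le) hz
    have := tendsto_nhds_unique h1 h2
    exact sub_eq_zero.1 (abs_eq_zero.1 this)

lemma jumpTime_le (n : ℝ≥0 → ℕ) (t : ℝ≥0) : jumpTime n (n t) ≤ t :=
  csInf_le (OrderBot.bddBelow _) (by simp)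

/-- The infimum is attained: a right-continuous ℕ-valued path is constant just to the right of each
point. -/
lemma apply_jumpTime {n : ℝ≥0 → ℕ} (hm : Monotone n)
    (hc : ∀ t : ℝ≥0, ContinuousWithinAt n (Ici t) t) (t : ℝ≥0) :
    n (jumpTime n (n t)) = n t := by
  refine le_antisymm (hm (jumpTime_le n t)) ?_
  set τ := jumpTime n (n t) with hτ
  have hne : {s : ℝ≥0 | n t ≤ n s}.Nonempty := ⟨t, le_refl (n t)⟩
  have hev : ∀ᶠ s in 𝓝[≥] τ, n s = n τ := by
    have := (hc τ).eventually (IsOpen.mem_nhds (isOpen_discrete {n τ}) rfl)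
    exact this
  have hcl : τ ∈ closure {s : ℝ≥0 | n t ≤ n s} := csInf_mem_closure hne (OrderBot.bddBelow _)
  have hfr : ∃ᶠ s in 𝓝[≥] τ, n t ≤ n s := by
    rw [frequently_nhdsWithin_iff]
    refine (mem_closure_iff_frequently.1 hcl).mono fun s hs => ⟨hs, ?_⟩
    exact csInf_le (OrderBot.bddBelow _) hs
  obtain ⟨s, hs1, hs2⟩ := (hfr.and_eventually hev).exists
  exact hs2 ▸ hs1

lemma jumpTime_le_iff {n : ℝ≥0 → ℕ} (hm : Monotone n)
    (hc : ∀ t : ℝ≥0, ContinuousWithinAt n (Ici t) t) {s t : ℝ≥0} (hst : s ≤ t) :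
    jumpTime n (n t) ≤ s ↔ n s = n t := by
  constructor
  · intro h
    exact le_antisymm (hm hst) ((apply_jumpTime hm hc t).symm.le.trans (hm h))
  · intro h
    exact csInf_le (OrderBot.bddBelow _) h.symm.le

lemma resetPath_of_jumpTime_le {n : ℝ≥0 → ℕ} (hm : Monotone n)
    (hc : ∀ t : ℝ≥0, ContinuousWithinAt n (Ici t) t) (b : ℝ≥0 → ℝ) {s t : ℝ≥0} (hst : s ≤ t)
    (h : jumpTime n (n t) ≤ s) :
    resetPath b n s = b s - b (jumpTime n (n t)) := by
  rw [resetPath, (jumpTime_le_iff hm hc hst).1 h]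

lemma lastZero_resetPath_lt_iff {n : ℝ≥0 → ℕ} (hm : Monotone n)
    (hc : ∀ t : ℝ≥0, ContinuousWithinAt n (Ici t) t) {b : ℝ≥0 → ℝ} (hb : Continuous b)
    (t : ℝ≥0) :
    lastZero (resetPath b n) < t ↔
      jumpTime n (n 1) < t ∧ ¬ ∃ u ∈ Icc t 1, b u = b (jumpTime n (n 1)) := by
  set τ := jumpTime n (n 1) with hτ
  have hτ1 : τ ≤ 1 := jumpTime_le n 1
  have hx : ∀ s, τ ≤ s → s ≤ 1 → resetPath b n s = b s - b τ := fun s h1 h2 =>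
    resetPath_of_jumpTime_le hm hc b h2 h1
  have hbdd : BddAbove {t : ℝ≥0 | t ≤ 1 ∧ resetPath b n t = 0} := ⟨1, fun _ h => h.1⟩
  rw [lastZero, NNReal.coe_lt_coe]
  have hmem : τ ∈ {t : ℝ≥0 | t ≤ 1 ∧ resetPath b n t = 0} :=
    ⟨hτ1, by rw [hx τ le_rfl hτ1, sub_self]⟩
  constructor
  · intro h
    have hlt : τ < t := (le_csSup hbdd hmem).trans_lt h
    refine ⟨hlt, ?_⟩
    rintro ⟨u, hu, hbu⟩
    have : u ∈ {t : ℝ≥0 | t ≤ 1 ∧ resetPath b n t = 0} :=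
      ⟨hu.2, by rw [hx u (hlt.le.trans hu.1) hu.2, hbu, sub_self]⟩
    exact absurd ((le_csSup hbdd this).trans_lt h) (not_lt.2 hu.1)
  · rintro ⟨hlt, hno⟩
    -- The zero set of the reset path need not be closed, since the path jumps at resets. Its part
    -- after τ is compact, so the supremum is attained, which gives the strict inequality.
    set K := Icc τ 1 ∩ {u | b u = b τ} with hK
    have hKc : IsCompact K :=
      isCompact_Icc.inter_right (isClosed_eq hb continuous_const)
    have hKτ : τ ∈ K := ⟨⟨le_rfl, hτ1⟩, rfl⟩
    have hs : sSup K ∈ K := hKc.sSup_mem ⟨τ, hKτ⟩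
    have hKlt : sSup K < t := by
      by_contra hge
      exact hno ⟨sSup K, ⟨not_lt.1 hge, hs.1.2⟩, hs.2⟩
    refine (csSup_le ⟨τ, hmem⟩ ?_).trans_lt hKlt
    rintro u ⟨hu1, hu0⟩
    rcases lt_or_ge u τ with h | h
    · exact h.le.trans (le_csSup hKc.bddAbove hKτ)
    · exact le_csSup hKc.bddAbove ⟨⟨h, hu1⟩, by
        rw [hx u h hu1, sub_eq_zero] at hu0; exact hu0⟩

/-- A version of the last jump time before `1` of a counting path which depends measurably on
the path. -/
noncomputable def lastReset (n : ℝ≥0 → ℕ) : ℝ≥0 :=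
  ⨅ i : ℕ, if n (TopologicalSpace.denseSeq ℝ≥0 i) = n 1 then
    min (TopologicalSpace.denseSeq ℝ≥0 i) 1 else 1

lemma measurable_lastReset : Measurable lastReset := by
  refine Measurable.iInf fun i => ?_
  refine Measurable.ite ?_ measurable_const measurable_const
  exact measurableSet_eq_fun (measurable_pi_apply _) (measurable_pi_apply _)

/-- Every term is at least τ, including the default 1, because τ ≤ 1. The path is constant on [τ,
1], so dense times in (τ, 1) bring the infimum down to τ; if τ = 1 any term will do. -/
lemma lastReset_eq_jumpTime {n : ℝ≥0 → ℕ} (hm : Monotone n)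
    (hc : ∀ t : ℝ≥0, ContinuousWithinAt n (Ici t) t) : lastReset n = jumpTime n (n 1) := by
  have hτ1 := jumpTime_le n 1
  apply le_antisymm
  · refine le_of_forall_gt fun c hc' => ?_
    rcases hτ1.eq_or_lt with h | h
    · refine (ciInf_le (OrderBot.bddBelow _) 0).trans_lt (lt_of_le_of_lt ?_ (h ▸ hc'))
      split_ifs <;> simp
    · obtain ⟨i, hi⟩ := (TopologicalSpace.denseRange_denseSeq ℝ≥0).exists_mem_open
        (isOpen_Ioo (a := jumpTime n (n 1)) (b := min c 1)) (nonempty_Ioo.2 (lt_min hc' h))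
      have h1 := hi.2.trans_le (min_le_right _ _)
      refine (ciInf_le (OrderBot.bddBelow _) i).trans_lt ?_
      rw [if_pos ((jumpTime_le_iff hm hc h1.le).1 hi.1.le)]
      exact (min_le_left _ _).trans_lt (hi.2.trans_le (min_le_left _ _))
  · refine le_ciInf fun i => ?_
    split_ifs with h
    · exact le_min (csInf_le (OrderBot.bddBelow _) h.symm.le) hτ1
    · exact hτ1

end Paths


/-! ### The correlation of the signs of two Gaussian variables -/

section Sign

@[fun_prop]
lemma measurable_realSign : Measurable Real.sign := by
  unfold Real.sign
  refine Measurable.ite measurableSet_Iio measurable_const ?_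
  exact Measurable.ite measurableSet_Ioi measurable_const measurable_const

lemma abs_realSign_le_one (x : ℝ) : |Real.sign x| ≤ 1 := by
  rcases Real.sign_apply_eq x with h | h | h <;> simp [h]

lemma tendsto_realSign {x : ℝ} (hx : x ≠ 0) : Tendsto Real.sign (𝓝 x) (𝓝 (Real.sign x)) := by
  rcases hx.lt_or_gt with h | h
  · refine tendsto_const_nhds.congr' ?_
    filter_upwards [Iio_mem_nhds h] with y hy
    rw [Real.sign_of_neg h, Real.sign_of_neg hy]
  · refine tendsto_const_nhds.congr' ?_
    filter_upwards [Ioi_mem_nhds h] with y hy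
    rw [Real.sign_of_pos h, Real.sign_of_pos hy]

/-- If |y| < |x|, both x + y and x - y have the sign of x; if |y| > |x|, their signs are opposite
and cancel. -/
lemma realSign_symmetrization {x y : ℝ} (hx : x ≠ 0) (hxy : |y| ≠ |x|) :
    Real.sign x * Real.sign (x + y) + Real.sign x * Real.sign (x - y) =
      2 * (Ioo (-1 : ℝ) 1).indicator 1 (y / x) := by
  have hmem : y / x ∈ Ioo (-1 : ℝ) 1 ↔ |y| < |x| := by
    rw [mem_Ioo, ← abs_lt, abs_div, div_lt_one (abs_pos.2 hx)]
  rcases hxy.lt_or_gt with h | h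
  · rw [indicator_of_mem (hmem.2 h)]
    rcases hx.lt_or_gt with h0 | h0
    · rw [abs_of_neg h0, abs_lt] at h
      rw [Real.sign_of_neg h0, Real.sign_of_neg (by linarith), Real.sign_of_neg (by linarith)]
      norm_num
    · rw [abs_of_pos h0, abs_lt] at h
      rw [Real.sign_of_pos h0, Real.sign_of_pos (by linarith), Real.sign_of_pos (by linarith)]
      norm_num
  · rw [indicator_of_notMem (fun h' => lt_asymm h (hmem.1 h'))]
    rcases lt_abs.1 h with h' | h'
    · have := neg_abs_le x
      have := le_abs_self x
      rw [Real.sign_of_pos (r := x + y) (by linarith),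
        Real.sign_of_neg (r := x - y) (by linarith)]
      ring
    · have := neg_abs_le x
      have := le_abs_self x
      rw [Real.sign_of_neg (r := x + y) (by linarith),
        Real.sign_of_pos (r := x - y) (by linarith)]
      ring

lemma integral_abs_mul_exp_neg_mul_sq {β : ℝ} (hβ : 0 < β) :
    ∫ x : ℝ, |x| * Real.exp (-β * x ^ 2) = 1 / β := by
  have h := integral_comp_abs (f := fun x => x * Real.exp (-β * x ^ 2))
  simp only [sq_abs] at h
  rw [h]
  have h2 := integral_rpow_mul_exp_neg_mul_rpow (p := 2) (q := 1) (b := β) (by norm_num)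
    (by norm_num) hβ
  simp only [Real.rpow_one, Real.rpow_two] at h2
  rw [h2]
  norm_num [Real.rpow_neg_one]
  ring

lemma gaussianPDFReal_mul_gaussianPDFReal {a b : ℝ≥0} (ha : 0 < a) (hb : 0 < b) (x z : ℝ) :
    gaussianPDFReal 0 a x * gaussianPDFReal 0 b (x * z) =
      (2 * Real.pi * (√a * √b))⁻¹ * Real.exp (-((b + a * z ^ 2) / (2 * (a * b))) * x ^ 2) := by
  have ha' : (0 : ℝ) < a := by exact_mod_cast ha
  have hb' : (0 : ℝ) < b := by exact_mod_cast hb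
  simp only [gaussianPDFReal, sub_zero]
  rw [mul_mul_mul_comm, ← Real.exp_add, ← mul_inv]
  congr 2
  · rw [Real.sqrt_mul (by positivity) (a : ℝ), Real.sqrt_mul (by positivity) (b : ℝ)]
    have := Real.mul_self_sqrt (show (0 : ℝ) ≤ 2 * Real.pi by positivity)
    linear_combination (√(a : ℝ) * √(b : ℝ)) * this
  · field_simp
    ring

/-- Averaging over y ↦ -y leaves the Gaussian mass of |y| < |x|. The substitution y = xz makes the
domain independent of x, ready for Fubini. -/
lemma integral_realSign_gaussianReal {b : ℝ≥0} (hb : 0 < b) (x : ℝ) :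
    ∫ y, Real.sign x * Real.sign (x + y) ∂gaussianReal 0 b =
      |x| * ∫ z in Ioo (-1 : ℝ) 1, gaussianPDFReal 0 b (x * z) := by
  rcases eq_or_ne x 0 with rfl | hx
  · simp
  have hint : ∀ f : ℝ → ℝ, Measurable f →
      Integrable (fun y => Real.sign x * Real.sign (f y)) (gaussianReal 0 b) := fun f hf =>
    Integrable.of_bound (by fun_prop : Measurable _).aestronglyMeasurable (1 * 1)
      (ae_of_all _ fun y => by
        rw [Real.norm_eq_abs, abs_mul]
        exact mul_le_mul (abs_realSign_le_one _) (abs_realSign_le_one _) (abs_nonneg _) zero_le_one)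
  have hneg : ∫ y, Real.sign x * Real.sign (x + y) ∂gaussianReal 0 b =
      ∫ y, Real.sign x * Real.sign (x - y) ∂gaussianReal 0 b := by
    conv_lhs => rw [← neg_zero, ← gaussianReal_map_neg]
    rw [integral_map (by fun_prop) (by fun_prop : Measurable _).aestronglyMeasurable]
    simp [sub_eq_add_neg]
  have hne : ∀ᵐ y ∂gaussianReal 0 b, |y| ≠ |x| := by
    have : NullSingletonClass (gaussianReal 0 b) := nullSingletonClass_gaussianReal hb.ne'
    have h1 : ∀ᵐ y ∂gaussianReal 0 b, y ≠ x := by simp [ae_iff, measure_singleton]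
    have h2 : ∀ᵐ y ∂gaussianReal 0 b, y ≠ -x := by simp [ae_iff, measure_singleton]
    filter_upwards [h1, h2] with y h1 h2 h
    rcases abs_eq_abs.1 h with h | h
    exacts [h1 h, h2 h]
  have key : ∫ y, Real.sign x * Real.sign (x + y) ∂gaussianReal 0 b =
      ∫ y, (Ioo (-1 : ℝ) 1).indicator (1 : ℝ → ℝ) (y / x) ∂gaussianReal 0 b := by
    have h2 : 2 * ∫ y, Real.sign x * Real.sign (x + y) ∂gaussianReal 0 b =
        2 * ∫ y, (Ioo (-1 : ℝ) 1).indicator (1 : ℝ → ℝ) (y / x) ∂gaussianReal 0 b := by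
      rw [two_mul]
      conv_lhs => rw [hneg]; arg 1; rw [← hneg]
      rw [← integral_add (hint _ (by fun_prop)) (hint _ (by fun_prop)), ← integral_const_mul]
      exact integral_congr_ae (hne.mono fun y hy => realSign_symmetrization hx hy)
    linarith
  rw [key, integral_gaussianReal_eq_integral_smul hb.ne']
  have hsub := Measure.integral_comp_mul_left
    (fun y => gaussianPDFReal 0 b y • (Ioo (-1 : ℝ) 1).indicator (1 : ℝ → ℝ) (y / x)) x
  simp only [mul_div_cancel_left₀ _ hx, smul_eq_mul] at hsub
  rw [← integral_indicator measurableSet_Ioo]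
  have : ∀ z, (Ioo (-1 : ℝ) 1).indicator (fun z => gaussianPDFReal 0 b (x * z)) z =
      gaussianPDFReal 0 b (x * z) * (Ioo (-1 : ℝ) 1).indicator (1 : ℝ → ℝ) z := fun z => by
    by_cases hz : z ∈ Ioo (-1 : ℝ) 1 <;> simp [hz]
  simp_rw [this, hsub, smul_eq_mul]
  rw [abs_inv, mul_inv_cancel_left₀ (abs_pos.2 hx).ne']

lemma integral_integral_realSign_gaussianReal {a b : ℝ≥0} (ha : 0 < a) (hb : 0 < b) :
    ∫ x, ∫ y, Real.sign x * Real.sign (x + y) ∂gaussianReal 0 b ∂gaussianReal 0 a =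
      2 / Real.pi * Real.arctan (√a / √b) := by
  have ha' : (0 : ℝ) < a := by exact_mod_cast ha
  have hb' : (0 : ℝ) < b := by exact_mod_cast hb
  simp_rw [integral_realSign_gaussianReal hb]
  rw [integral_gaussianReal_eq_integral_smul ha.ne']
  have hexp : ∀ x z : ℝ, gaussianPDFReal 0 a x * (|x| * gaussianPDFReal 0 b (x * z)) =
      (2 * Real.pi * (√a * √b))⁻¹ *
        (|x| * Real.exp (-((b + a * z ^ 2) / (2 * (a * b))) * x ^ 2)) := fun x z => by
    rw [mul_left_comm, gaussianPDFReal_mul_gaussianPDFReal ha hb]; ring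
  have hint : Integrable (Function.uncurry fun x z =>
      gaussianPDFReal 0 a x * (|x| * gaussianPDFReal 0 b (x * z)))
      (volume.prod (volume.restrict (Ioo (-1 : ℝ) 1))) := by
    have h1 : Integrable (fun x : ℝ => (2 * Real.pi * (√a * √b))⁻¹ *
        (x * Real.exp (-(1 / (2 * a)) * x ^ 2))) :=
      (integrable_mul_exp_neg_mul_sq (by positivity)).const_mul _
    have h2 : Integrable (fun _ : ℝ => (1 : ℝ)) (volume.restrict (Ioo (-1 : ℝ) 1)) :=
      integrable_const _
    refine (h1.mul_prod h2).mono ?_ (ae_of_all _ fun p => ?_)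
    · exact (by fun_prop : Measurable _).aestronglyMeasurable
    · simp only [Function.uncurry, hexp, mul_one, norm_mul, Real.norm_eq_abs, abs_abs, Real.abs_exp]
      -- Dropping the z² term of the exponent gives a dominating function of x alone.
      have hle : 1 / (2 * (a : ℝ)) ≤ (b + a * p.2 ^ 2) / (2 * (a * b)) := by
        have : (b : ℝ) / (2 * (a * b)) = 1 / (2 * a) := by field_simp
        rw [← this, div_le_div_iff_of_pos_right (by positivity)]
        nlinarith [sq_nonneg p.2]
      gcongr |_| * (|_| * Real.exp (-?_ * _))
  simp_rw [smul_eq_mul, ← integral_const_mul]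
  rw [integral_integral_swap hint]
  have hz : ∀ z : ℝ, ∫ x, gaussianPDFReal 0 a x * (|x| * gaussianPDFReal 0 b (x * z)) =
      (Real.pi)⁻¹ * ((√a / √b) * (1 + (√a / √b * z) ^ 2)⁻¹) := fun z => by
    simp_rw [hexp]
    rw [integral_const_mul, integral_abs_mul_exp_neg_mul_sq (by positivity)]
    have hA : (√(a : ℝ)) ^ 2 = a := Real.sq_sqrt ha'.le
    have hB : (√(b : ℝ)) ^ 2 = b := Real.sq_sqrt hb'.le
    have hA0 : 0 < √(a : ℝ) := Real.sqrt_pos.2 ha'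
    have hB0 : 0 < √(b : ℝ) := Real.sqrt_pos.2 hb'
    generalize √(a : ℝ) = A at *
    generalize √(b : ℝ) = B at *
    rw [← hA, ← hB]
    field_simp
  simp_rw [hz]
  rw [integral_const_mul, ← integral_Ioc_eq_integral_Ioo,
    ← intervalIntegral.integral_of_le (by norm_num), intervalIntegral.integral_const_mul,
    intervalIntegral.mul_integral_comp_mul_left (f := fun z => (1 + z ^ 2)⁻¹),
    integral_inv_one_add_sq]
  simp only [mul_neg, mul_one, Real.arctan_neg]
  ring

end Sign


/-! ### Zeros of Brownian motion -/

section Grid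

/-- A monotone predicate switches on once, so only one difference of indicators is nonzero. -/
lemma exists_sum_indicator_sub_mul {p : ℕ → Prop} [DecidablePred p] (hp : Monotone p)
    (h0 : ¬ p 0) {m : ℕ} (hm : p m) (f : ℕ → ℝ) :
    ∃ k, ¬ p k ∧ p (k + 1) ∧ k < m ∧
      ∑ k ∈ Finset.range m, ((if p (k + 1) then (1 : ℝ) else 0) - if p k then 1 else 0) * f k =
        f k := by
  obtain ⟨k, hk⟩ : ∃ k, Nat.find ⟨m, hm⟩ = k + 1 :=
    Nat.exists_eq_succ_of_ne_zero fun h => h0 (h ▸ Nat.find_spec (p := p) ⟨m, hm⟩)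
  have hk1 : p (k + 1) := hk ▸ Nat.find_spec (p := p) ⟨m, hm⟩
  have hk0 : ¬ p k := Nat.find_min (p := p) ⟨m, hm⟩ (by omega)
  have hkm : k < m := by
    by_contra h
    exact hk0 (hp (not_lt.1 h) hm)
  refine ⟨k, hk0, hk1, hkm, ?_⟩
  rw [Finset.sum_eq_single_of_mem k (Finset.mem_range.2 hkm)]
  · simp [hk0, hk1]
  · intro j _ hj
    rcases hj.lt_or_gt with h | h
    · have h1 : ¬ p (j + 1) := fun h' => hk0 (hp h h')
      have h2 : ¬ p j := fun h' => hk0 (hp h.le h')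
      simp [h1, h2]
    · have h1 : p (j + 1) := hp (by omega) hk1
      have h2 : p j := hp h hk1
      simp [h1, h2]

/-- The `k`-th point of the division of `[a, c]` into `m + 1` intervals of equal length. -/
noncomputable def gridPoint (a c : ℝ≥0) (m k : ℕ) : ℝ≥0 := a + k * ((c - a) / ((m : ℝ≥0) + 1))

lemma gridPoint_zero (a c : ℝ≥0) (m : ℕ) : gridPoint a c m 0 = a := by simp [gridPoint]

lemma gridPoint_last {a c : ℝ≥0} (hac : a ≤ c) (m : ℕ) : gridPoint a c m (m + 1) = c := by
  rw [gridPoint, Nat.cast_add_one, mul_div_cancel₀ _ (by positivity), add_tsub_cancel_of_le hac]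

lemma gridPoint_mono (a c : ℝ≥0) (m : ℕ) : Monotone (gridPoint a c m) := fun j k h => by
  unfold gridPoint; gcongr

lemma gridPoint_succ (a c : ℝ≥0) (m k : ℕ) :
    gridPoint a c m (k + 1) = gridPoint a c m k + (c - a) / ((m : ℝ≥0) + 1) := by
  simp only [gridPoint]; push_cast; ring

open Classical in
/-- The sign of `x a` times the sign of the increment of `x` from the first grid point after the
first zero of `x` in `[a, c]` to `c`. -/
noncomputable def gridSign (x : ℝ≥0 → ℝ) (a c : ℝ≥0) (m : ℕ) : ℝ :=
  ∑ k ∈ Finset.range (m + 1),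
    ((if ∃ u ∈ Icc a (gridPoint a c m (k + 1)), x u = 0 then (1 : ℝ) else 0) -
      if ∃ u ∈ Icc a (gridPoint a c m k), x u = 0 then 1 else 0) *
      (Real.sign (x a) * Real.sign (x c - x (gridPoint a c m (k + 1))))

lemma gridSign_eq_zero {x : ℝ≥0 → ℝ} {a c : ℝ≥0} (hac : a ≤ c)
    (h : x a = 0 ∨ ¬ ∃ u ∈ Icc a c, x u = 0) (m : ℕ) : gridSign x a c m = 0 := by
  refine Finset.sum_eq_zero fun k hk => ?_
  rcases h with h | h
  · simp [h]
  · have : ∀ j ≤ m + 1, ¬ ∃ u ∈ Icc a (gridPoint a c m j), x u = 0 := by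
      rintro j hj ⟨u, hu, h0⟩
      exact h ⟨u, ⟨hu.1, hu.2.trans ((gridPoint_mono a c m hj).trans (gridPoint_last hac m).le)⟩,
        h0⟩
    have hk := Finset.mem_range.1 hk
    rw [if_neg (this _ (by omega)), if_neg (this _ (by omega))]
    simp

lemma exists_gridSign_eq {x : ℝ≥0 → ℝ} {a c : ℝ≥0} (hac : a ≤ c) (ha : x a ≠ 0)
    (h : ∃ u ∈ Icc a c, x u = 0) (m : ℕ) :
    ∃ u v, u ∈ Icc a c ∧ v ∈ Icc a c ∧ x u = 0 ∧ dist v u ≤ ((c - a) / ((m : ℝ≥0) + 1) : ℝ≥0) ∧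
      gridSign x a c m = Real.sign (x a) * Real.sign (x c - x v) := by
  classical
  obtain ⟨k, hk0, ⟨u, hu, hu0⟩, hkm, hsum⟩ :=
    exists_sum_indicator_sub_mul (p := fun k => ∃ u ∈ Icc a (gridPoint a c m k), x u = 0)
      (fun i j hij => by
        rintro ⟨u, hu, h0⟩
        exact ⟨u, ⟨hu.1, hu.2.trans (gridPoint_mono a c m hij)⟩, h0⟩)
      (by
        rintro ⟨u, hu, h0⟩
        rw [gridPoint_zero, Icc_self, mem_singleton_iff] at hu
        exact ha (hu ▸ h0))
      (m := m + 1) (by rwa [gridPoint_last hac])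
      (fun k => Real.sign (x a) * Real.sign (x c - x (gridPoint a c m (k + 1))))
  have hle : gridPoint a c m (k + 1) ≤ c :=
    (gridPoint_mono a c m hkm).trans (gridPoint_last hac m).le
  have hgt : gridPoint a c m k < u := by
    by_contra hle
    exact hk0 ⟨u, ⟨hu.1, not_lt.1 hle⟩, hu0⟩
  refine ⟨u, gridPoint a c m (k + 1), ⟨hu.1, hu.2.trans hle⟩, ⟨hu.1.trans hu.2, hle⟩, hu0, ?_, ?_⟩
  · rw [NNReal.dist_eq, abs_of_nonneg (sub_nonneg.2 (NNReal.coe_le_coe.2 hu.2)), sub_le_iff_le_add,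
      ← NNReal.coe_add, NNReal.coe_le_coe, gridPoint_succ, add_comm]
    gcongr
  · rw [gridSign]
    convert hsum

lemma abs_gridSign_le_one (x : ℝ≥0 → ℝ) {a c : ℝ≥0} (hac : a ≤ c) (m : ℕ) :
    |gridSign x a c m| ≤ 1 := by
  by_cases h : x a = 0 ∨ ¬ ∃ u ∈ Icc a c, x u = 0
  · simp [gridSign_eq_zero hac h]
  · push Not at h
    obtain ⟨u, v, -, -, -, -, h⟩ := exists_gridSign_eq hac h.1 h.2 m
    rw [h, abs_mul]
    exact mul_le_one₀ (abs_realSign_le_one _) (abs_nonneg _) (abs_realSign_le_one _)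

open Classical in
-- The grid point v following a zero u satisfies x(v) → 0. The zero chosen may vary with the mesh,
-- hence uniform continuity on [a, c]. The sign passes to the limit because x(c) ≠ 0.
lemma tendsto_gridSign {x : ℝ≥0 → ℝ} (hx : Continuous x) {a c : ℝ≥0} (hac : a ≤ c)
    (hc : x c ≠ 0) :
    Tendsto (gridSign x a c) atTop
      (𝓝 ((if ∃ u ∈ Icc a c, x u = 0 then 1 else 0) *
        (Real.sign (x a) * Real.sign (x c)))) := by
  by_cases h : x a = 0 ∨ ¬ ∃ u ∈ Icc a c, x u = 0
  · have : gridSign x a c = fun _ => 0 := funext (gridSign_eq_zero hac h)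
    rw [this]
    rcases h with h | h
    · simp [h]
    · simp only [if_neg h, zero_mul, tendsto_const_nhds]
  · push Not at h
    rw [if_pos h.2, one_mul]
    choose u v hu hv hu0 huv hval using exists_gridSign_eq hac h.1 h.2
    have hz : Tendsto (fun m : ℕ => (((c - a) / ((m : ℝ≥0) + 1) : ℝ≥0) : ℝ)) atTop (𝓝 0) := by
      have := (tendsto_one_div_add_atTop_nhds_zero_nat (𝕜 := ℝ)).const_mul ((c - a : ℝ≥0) : ℝ)
      simp only [mul_zero] at this
      refine this.congr fun m => ?_
      push_cast
      ring
    have hd : Tendsto (fun m => dist (v m) (u m)) atTop (𝓝 0) :=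
      squeeze_zero (fun _ => dist_nonneg) huv hz
    have hlim : Tendsto (fun m => x (v m)) atTop (𝓝 0) := by
      rw [Metric.tendsto_atTop]
      intro ε hε
      obtain ⟨δ, hδ, hunif⟩ := Metric.uniformContinuousOn_iff.1
        (isCompact_Icc.uniformContinuousOn_of_continuous hx.continuousOn) ε hε
      obtain ⟨M, hM⟩ := eventually_atTop.1 (hd.eventually (gt_mem_nhds hδ))
      exact ⟨M, fun m hm => by simpa [hu0] using hunif _ (hv m) _ (hu m) (hM m hm)⟩
    have hlim2 : Tendsto (fun m => x c - x (v m)) atTop (𝓝 (x c)) := by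
      simpa using hlim.const_sub (x c)
    exact (((tendsto_realSign hc).comp hlim2).const_mul _).congr fun m => (hval m).symm

end Grid

/-! ### Probability that a Brownian motion has no zero in an interval. -/

section Brownian

variable {Ω : Type*} [MeasurableSpace Ω] {P : Measure Ω}
  {W : ℝ≥0 → Ω → ℝ}

/-- A Brownian motion has a version that is measurable and whose paths are all continuous. -/
lemma exists_continuous_version {B : ℝ≥0 → Ω → ℝ} (hB : IsBrownianReal B P) :
    ∃ W : ℝ≥0 → Ω → ℝ, (∀ t, Measurable (W t)) ∧ (∀ ω, Continuous (W · ω)) ∧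
      IsBrownianReal W P ∧ ∀ᵐ ω ∂P, ∀ t, W t ω = B t ω := by
  classical
  set q := TopologicalSpace.denseSeq ℝ≥0 with hq
  have hgood : ∀ᵐ ω ∂P, Continuous (B · ω) ∧
      ∀ i, B (q i) ω = (hB.aemeasurable (q i)).mk (B (q i)) ω :=
    hB.cont.and (ae_all_iff.2 fun i => (hB.aemeasurable (q i)).ae_eq_mk)
  -- A measurable null hull of the bad paths: setting the process to 0 there preserves
  -- measurability.
  set S := toMeasurable P {ω | ¬ (Continuous (B · ω) ∧
      ∀ i, B (q i) ω = (hB.aemeasurable (q i)).mk (B (q i)) ω)} with hS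
  have hSnull : P S = 0 := by rw [hS, measure_toMeasurable]; exact hgood
  have hSm : MeasurableSet S := measurableSet_toMeasurable _ _
  have hSc : ∀ ω ∉ S, Continuous (B · ω) ∧
      ∀ i, B (q i) ω = (hB.aemeasurable (q i)).mk (B (q i)) ω := fun ω hω => by
    by_contra h
    exact hω (subset_toMeasurable _ _ h)
  have hcont : ∀ ω, Continuous fun t => if ω ∈ S then 0 else B t ω := fun ω => by
    by_cases h : ω ∈ S
    · simpa [h] using continuous_const
    · simpa [h] using (hSc ω h).1
  have heq : ∀ᵐ ω ∂P, ∀ t, (if ω ∈ S then 0 else B t ω) = B t ω := by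
    have : ∀ᵐ ω ∂P, ω ∉ S := by simpa [ae_iff] using hSnull
    filter_upwards [this] with ω hω t
    simp [hω]
  refine ⟨fun t ω => if ω ∈ S then 0 else B t ω, fun t => ?_, hcont, ⟨?_, ae_of_all _ hcont⟩, heq⟩
  · have hqm : ∀ i, Measurable fun ω => if ω ∈ S then 0 else B (q i) ω := fun i => by
      have : (fun ω => if ω ∈ S then 0 else B (q i) ω) =
          fun ω => if ω ∈ S then 0 else (hB.aemeasurable (q i)).mk (B (q i)) ω := by
        ext ω
        split_ifs with h
        · rfl
        · exact (hSc ω h).2 i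
      rw [this]
      exact Measurable.ite hSm measurable_const (hB.aemeasurable (q i)).measurable_mk
    obtain ⟨u, hu, hlim⟩ := mem_closure_iff_seq_limit.1
      (TopologicalSpace.denseRange_denseSeq ℝ≥0 t)
    choose i hi using hu
    refine measurable_of_tendsto_metrizable (fun n => hqm (i n)) (tendsto_pi_nhds.2 fun ω => ?_)
    have := ((hcont ω).tendsto t).comp hlim
    simpa [Function.comp_def, ← hi] using this
  · refine hB.toIsPreBrownianReal.congr fun t => ?_
    filter_upwards [heq] with ω hω using (hω t).symm

/-- Exhibits the event as a function of the path up to t, the form required by the independence of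
past and future. -/
lemma exists_measurableSet_preimage_zero {Ω : Type*} {W : ℝ≥0 → Ω → ℝ}
    (hWc : ∀ ω, Continuous (W · ω)) {a t : ℝ≥0}
    (hat : a ≤ t) :
    ∃ S : Set (Iic t → ℝ), MeasurableSet S ∧
      {ω | ∃ u ∈ Icc a t, W u ω = 0} = (fun ω (u : Iic t) => W u ω) ⁻¹' S := by
  rcases hat.eq_or_lt with rfl | hat
  · exact ⟨{b | b ⟨a, self_mem_Iic⟩ = 0},
      measurableSet_eq_fun (measurable_pi_apply _) measurable_const, by ext ω; simp⟩
  set q := TopologicalSpace.denseSeq ℝ≥0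
  refine ⟨⋂ m : ℕ, ⋃ i : {i // q i ∈ Icc a t},
    {b | |b ⟨q i, i.2.2⟩| < 1 / ((m : ℝ) + 1)}, ?_, ?_⟩
  · refine MeasurableSet.iInter fun m => MeasurableSet.iUnion fun i => ?_
    exact measurableSet_lt (by fun_prop) (by fun_prop)
  · ext ω
    rw [mem_ofPred_eq, exists_apply_eq_iff_dense (hWc ω)
      (TopologicalSpace.denseRange_denseSeq ℝ≥0) hat 0]
    simp [q]

lemma measurableSet_exists_zero (hWm : ∀ t, Measurable (W t)) (hWc : ∀ ω, Continuous (W · ω))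
    {a t : ℝ≥0} (hat : a ≤ t) : MeasurableSet {ω | ∃ u ∈ Icc a t, W u ω = 0} := by
  obtain ⟨S, hS, h⟩ := exists_measurableSet_preimage_zero hWc hat
  rw [h]
  exact (measurable_pi_lambda _ fun u : Iic t => hWm u) hS

lemma integral_realSign_gaussianReal_zero (v : ℝ≥0) :
    ∫ x, Real.sign x ∂gaussianReal 0 v = 0 := by
  have h : ∫ x, Real.sign x ∂gaussianReal 0 v = -∫ x, Real.sign x ∂gaussianReal 0 v := by
    conv_lhs => rw [← neg_zero, ← gaussianReal_map_neg]
    rw [integral_map (by fun_prop) measurable_realSign.aestronglyMeasurable]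
    simp [Real.sign_neg, integral_neg]
  linarith

open Classical in
-- The indicator and sign W(a) depend on the past of t; the increment after t is independent of it
-- and symmetric. Both s = t and s < t occur in `gridSign`.
lemma integral_zero_mul_realSign_increment [IsProbabilityMeasure P] (hW : IsBrownianReal W P)
    (hWm : ∀ t, Measurable (W t)) (hWc : ∀ ω, Continuous (W · ω)) {a s t c : ℝ≥0} (has : a ≤ s)
    (hst : s ≤ t) (htc : t ≤ c) :
    ∫ ω, (if ∃ u ∈ Icc a s, W u ω = 0 then (1 : ℝ) else 0) *
      (Real.sign (W a ω) * Real.sign (W c ω - W t ω)) ∂P = 0 := by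
  obtain ⟨S, hS, h⟩ := exists_measurableSet_preimage_zero hWc has
  have hcond : ∀ ω, (∃ u ∈ Icc a s, W u ω = 0) ↔ (fun u : Iic s => W u ω) ∈ S := fun ω =>
    iff_of_eq (congrFun h ω)
  have hind := hW.indepFun_shift t
  have hψ : Measurable fun b : Iic t → ℝ =>
      S.indicator (1 : (Iic s → ℝ) → ℝ) (fun u => b ⟨u, u.2.trans hst⟩) *
        Real.sign (b ⟨a, has.trans hst⟩) := by
    refine Measurable.mul ?_ (by fun_prop)
    exact (measurable_one.indicator hS).comp (by fun_prop)
  have hφ : Measurable fun b : ℝ≥0 → ℝ => Real.sign (b (c - t)) := by fun_prop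
  have hind' := (hind.comp hφ hψ).symm
  have hprod := hind'.integral_fun_mul_eq_mul_integral
    (hψ.comp (measurable_pi_lambda _ fun u => hWm u)).aestronglyMeasurable
    (hφ.comp (measurable_pi_lambda _ fun u => (hWm _).sub (hWm _))).aestronglyMeasurable
  have hzero : ∫ ω, Real.sign (W (t + (c - t)) ω - W t ω) ∂P = 0 := by
    have hl := ((hW.shift t).hasLaw_eval (c - t))
    rw [← integral_realSign_gaussianReal_zero (c - t), ← hl.map_eq,
      integral_map hl.aemeasurable measurable_realSign.aestronglyMeasurable]
  simp only [Function.comp_def] at hprod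
  rw [hzero, mul_zero, add_tsub_cancel_of_le htc] at hprod
  refine (integral_congr_ae (ae_of_all _ fun ω => ?_)).trans hprod
  simp only [hcond, indicator_apply, Pi.one_apply, mul_assoc]

lemma integrable_of_abs_le_one [IsProbabilityMeasure P] {f : Ω → ℝ} (hf : Measurable f) (h : ∀ ω, |f ω| ≤ 1) :
    Integrable f P :=
  Integrable.of_bound hf.aestronglyMeasurable 1 (ae_of_all _ h)

open Classical in
lemma integral_gridSign [IsProbabilityMeasure P] (hW : IsBrownianReal W P)
    (hWm : ∀ t, Measurable (W t)) (hWc : ∀ ω, Continuous (W · ω)) {a c : ℝ≥0} (hac : a ≤ c)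
    (m : ℕ) : ∫ ω, gridSign (W · ω) a c m ∂P = 0 := by
  have hmono := gridPoint_mono a c m
  have ha : ∀ k, a ≤ gridPoint a c m k := fun k =>
    (gridPoint_zero a c m).symm.le.trans (hmono k.zero_le)
  have hint : ∀ s t, a ≤ s → Integrable (fun ω => (if ∃ u ∈ Icc a s, W u ω = 0 then (1 : ℝ) else 0) *
      (Real.sign (W a ω) * Real.sign (W c ω - W t ω))) P := fun s t has => by
    refine integrable_of_abs_le_one ?_ fun ω => ?_
    · exact (Measurable.ite (measurableSet_exists_zero hWm hWc has) measurable_const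
        measurable_const).mul (by fun_prop)
    · rw [abs_mul, abs_mul]
      refine mul_le_one₀ (by split_ifs <;> simp) (by positivity) ?_
      exact mul_le_one₀ (abs_realSign_le_one _) (abs_nonneg _) (abs_realSign_le_one _)
  unfold gridSign
  simp only [sub_mul]
  refine (integral_finsetSum _ fun k _ => (hint _ (gridPoint a c m (k + 1)) (ha (k + 1))).sub
    (hint _ (gridPoint a c m (k + 1)) (ha k))).trans ?_
  refine Finset.sum_eq_zero fun k hk => ?_
  have hkc : gridPoint a c m (k + 1) ≤ c :=
    (hmono (Finset.mem_range.1 hk)).trans (gridPoint_last hac m).le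
  rw [integral_sub' (hint _ _ (ha _)) (hint _ _ (ha _)),
    integral_zero_mul_realSign_increment hW hWm hWc (ha _) le_rfl hkc,
    integral_zero_mul_realSign_increment hW hWm hWc (ha _) (hmono k.le_succ) hkc, sub_zero]

lemma ae_apply_ne_zero (hW : IsBrownianReal W P) {c : ℝ≥0} (hc : 0 < c) :
    ∀ᵐ ω ∂P, W c ω ≠ 0 := by
  have hl := hW.hasLaw_eval c
  have : NullSingletonClass (gaussianReal 0 c) := nullSingletonClass_gaussianReal hc.ne'
  refine (hl.ae_iff (p := fun x => x ≠ 0) (by measurability)).2 ?_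
  simp [ae_iff, measure_singleton]

/-- The probability that a Brownian motion has no zero in `[a, c]` is the correlation of the signs
of its values at `a` and `c`. -/
lemma measureReal_not_exists_zero [IsProbabilityMeasure P] (hW : IsBrownianReal W P)
    (hWm : ∀ t, Measurable (W t)) (hWc : ∀ ω, Continuous (W · ω)) {a c : ℝ≥0}
    (hac : a < c) :
    P.real {ω | ¬ ∃ u ∈ Icc a c, W u ω = 0} =
      ∫ ω, Real.sign (W a ω) * Real.sign (W c ω) ∂P := by
  classical
  have hZ := measurableSet_exists_zero hWm hWc hac.le
  have hzero : ∫ ω, (if ∃ u ∈ Icc a c, W u ω = 0 then (1 : ℝ) else 0) *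
      (Real.sign (W a ω) * Real.sign (W c ω)) ∂P = 0 := by
    have hlim := tendsto_integral_of_dominated_convergence (μ := P)
      (F := fun m ω => gridSign (W · ω) a c m)
      (f := fun ω => (if ∃ u ∈ Icc a c, W u ω = 0 then (1 : ℝ) else 0) *
        (Real.sign (W a ω) * Real.sign (W c ω))) (fun _ => 1) (fun m => ?_)
      (integrable_const _) (fun m => ae_of_all _ fun ω => ?_) ?_
    · simp only [integral_gridSign hW hWm hWc hac.le] at hlim
      exact tendsto_nhds_unique hlim tendsto_const_nhds |>.trans rfl
    · refine Measurable.aestronglyMeasurable ?_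
      refine Finset.measurable_sum _ fun k _ => Measurable.mul (Measurable.sub ?_ ?_) (by fun_prop)
      · exact Measurable.ite (measurableSet_exists_zero hWm hWc
          ((gridPoint_zero a c m).symm.le.trans (gridPoint_mono a c m (Nat.zero_le _))))
          measurable_const measurable_const
      · exact Measurable.ite (measurableSet_exists_zero hWm hWc
          ((gridPoint_zero a c m).symm.le.trans (gridPoint_mono a c m (Nat.zero_le _))))
          measurable_const measurable_const
    · exact abs_gridSign_le_one _ hac.le m
    · filter_upwards [ae_apply_ne_zero hW (pos_of_gt hac)] with ω hω
      exact tendsto_gridSign (hWc ω) hac.le hω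
  -- Without a zero, the intermediate value theorem forces equal signs at a and c, so their product
  -- is 1.
  have hpt : ∀ ω, {ω | ¬ ∃ u ∈ Icc a c, W u ω = 0}.indicator (1 : Ω → ℝ) ω =
      Real.sign (W a ω) * Real.sign (W c ω) -
        (if ∃ u ∈ Icc a c, W u ω = 0 then (1 : ℝ) else 0) *
          (Real.sign (W a ω) * Real.sign (W c ω)) := fun ω => by
    by_cases h : ∃ u ∈ Icc a c, W u ω = 0
    · rw [indicator_of_notMem (not_not.2 h), if_pos h]; ring
    · rw [indicator_of_mem h, if_neg h, zero_mul, sub_zero, Pi.one_apply]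
      have hne : ∀ u ∈ Icc a c, W u ω ≠ 0 := fun u hu h0 => h ⟨u, hu, h0⟩
      have ha := hne a (left_mem_Icc.2 hac.le)
      have hc := hne c (right_mem_Icc.2 hac.le)
      have hivt := intermediate_value_uIcc (f := (W · ω)) (a := a) (b := c) (hWc ω).continuousOn
      have h0 : (0 : ℝ) ∉ uIcc (W a ω) (W c ω) := fun h0 => by
        obtain ⟨u, hu, h0⟩ := hivt h0
        exact hne u (by rwa [uIcc_of_le hac.le] at hu) h0
      rcases ha.lt_or_gt with h1 | h1 <;> rcases hc.lt_or_gt with h2 | h2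
      · simp [Real.sign_of_neg h1, Real.sign_of_neg h2]
      · exact absurd (mem_uIcc.2 (Or.inl ⟨h1.le, h2.le⟩)) h0
      · exact absurd (mem_uIcc.2 (Or.inr ⟨h2.le, h1.le⟩)) h0
      · simp [Real.sign_of_pos h1, Real.sign_of_pos h2]
  have hss : ∀ ω, |Real.sign (W a ω) * Real.sign (W c ω)| ≤ 1 := fun ω => by
    rw [abs_mul]
    exact mul_le_one₀ (abs_realSign_le_one _) (abs_nonneg _) (abs_realSign_le_one _)
  have hZc : MeasurableSet {ω | ¬ ∃ u ∈ Icc a c, W u ω = 0} := hZ.compl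
  rw [← integral_indicator_one hZc]
  simp_rw [hpt]
  rw [integral_sub, hzero, sub_zero]
  · exact integrable_of_abs_le_one (by fun_prop) hss
  · refine integrable_of_abs_le_one
      ((Measurable.ite hZ measurable_const measurable_const).mul (by fun_prop)) fun ω => ?_
    rw [abs_mul]
    exact mul_le_one₀ (by split_ifs <;> simp) (abs_nonneg _) (hss ω)

lemma integral_realSign_mul_realSign [IsProbabilityMeasure P] (hW : IsBrownianReal W P) {a c : ℝ≥0} (ha : 0 < a)
    (hac : a < c) :
    ∫ ω, Real.sign (W a ω) * Real.sign (W c ω) ∂P =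
      2 / Real.pi * Real.arctan (√a / √(c - a : ℝ≥0)) := by
  have hind : IndepFun (W a) (W c - W a) P :=
    hW.hasIndepIncrements.indepFun_eval_sub zero_le hac.le hW.eval_zero_ae_eq_zero
  have hla := hW.hasLaw_eval a
  have hlc : HasLaw (W c - W a) (gaussianReal 0 (c - a)) P := by
    have := (hW.shift a).hasLaw_eval (c - a)
    rwa [add_tsub_cancel_of_le hac.le] at this
  have hmap := (indepFun_iff_map_prod_eq_prod_map_map hla.aemeasurable hlc.aemeasurable).1 hind
  rw [hla.map_eq, hlc.map_eq] at hmap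
  have hm : Measurable fun p : ℝ × ℝ => Real.sign p.1 * Real.sign (p.1 + p.2) := by fun_prop
  rw [← integral_integral_realSign_gaussianReal ha (tsub_pos_of_lt hac),
    ← integral_prod (fun p : ℝ × ℝ => Real.sign p.1 * Real.sign (p.1 + p.2)), ← hmap,
    integral_map (hla.aemeasurable.prodMk hlc.aemeasurable) hm.aestronglyMeasurable]
  · simp
  · refine integrable_of_abs_le_one hm fun p => ?_
    rw [abs_mul]
    exact mul_le_one₀ (abs_realSign_le_one _) (abs_nonneg _) (abs_realSign_le_one _)

/-- Returns to B(s) are zeros of the Brownian motion u ↦ B(s + u) - B(s), on the interval shifted by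
s. -/
lemma measure_not_exists_return [IsProbabilityMeasure P] {B : ℝ≥0 → Ω → ℝ} (hB : IsBrownianReal B P) {s t c : ℝ≥0}
    (hst : s < t) (htc : t < c) :
    P {ω | ¬ ∃ u ∈ Icc t c, B u ω = B s ω} =
      ENNReal.ofReal (2 / Real.pi * Real.arctan (√(t - s : ℝ) / √(c - t : ℝ))) := by
  obtain ⟨W, hWm, hWc, hW, hWB⟩ := exists_continuous_version hB
  have hV := hW.shift s
  have hts : t - s < c - s := tsub_lt_tsub_right_of_le hst.le htc
  have h1 := measureReal_not_exists_zero hV (fun u => (hWm _).sub (hWm _))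
    (fun ω => by have := hWc ω; fun_prop) hts
  rw [integral_realSign_mul_realSign hV (tsub_pos_of_lt hst) hts,
    tsub_tsub_tsub_cancel_right hst.le, NNReal.coe_sub hst.le, NNReal.coe_sub htc.le] at h1
  rw [← h1, ofReal_measureReal]
  refine measure_congr ?_
  filter_upwards [hWB] with ω hω
  refine propext (not_congr ?_)
  simp only [← hω]
  constructor
  · rintro ⟨u, hu, h⟩
    refine ⟨u - s, ⟨tsub_le_tsub_right hu.1 s, tsub_le_tsub_right hu.2 s⟩, ?_⟩
    rw [add_tsub_cancel_of_le (hst.le.trans hu.1), h, sub_self]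
  · rintro ⟨v, hv, h⟩
    refine ⟨s + v, ⟨?_, ?_⟩, sub_eq_zero.1 h⟩
    · exact tsub_le_iff_left.1 hv.1
    · have := (le_tsub_iff_left (hst.le.trans htc.le)).1 hv.2
      exact this

end Brownian


/-! ### Densities -/

section Densities

/-- The density at `v` of the arcsine law on `(s, 1)`. -/
noncomputable def arcsineKernel (s v : ℝ) : ℝ≥0∞ :=
  if s < v then ENNReal.ofReal (1 / (Real.pi * √((v - s) * (1 - v)))) else 0

lemma measurable_arcsineKernel : Measurable (Function.uncurry arcsineKernel) := by
  refine Measurable.ite ?_ (by fun_prop) measurable_const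
  exact measurableSet_lt (by fun_prop) (by fun_prop)

lemma hasDerivAt_arcsin_sqrt {s v : ℝ} (hsv : s < v) (hv : v < 1) :
    HasDerivAt (fun v => 2 / Real.pi * Real.arcsin √((v - s) / (1 - s)))
      (1 / (Real.pi * √((v - s) * (1 - v)))) v := by
  have h1s : 0 < 1 - s := by linarith
  have hvs : 0 < v - s := by linarith
  have h1v : 0 < 1 - v := by linarith
  have hw : 0 < (v - s) / (1 - s) := by positivity
  have hw1 : (v - s) / (1 - s) < 1 := by rw [div_lt_one h1s]; linarith
  have hsq := Real.sq_sqrt hw.le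
  have hlt : √((v - s) / (1 - s)) < 1 := by rw [Real.sqrt_lt' one_pos]; simpa using hw1
  have hd : HasDerivAt (fun v => (v - s) / (1 - s)) (1 / (1 - s)) v :=
    ((hasDerivAt_id v).sub_const s).div_const _
  have hpos := Real.sqrt_pos.2 hw
  have := (((Real.hasDerivAt_arcsin (by linarith) hlt.ne).comp v (hd.sqrt hw.ne')).const_mul
    (2 / Real.pi))
  refine this.congr_deriv ?_
  have e1 : 1 - √((v - s) / (1 - s)) ^ 2 = (1 - v) / (1 - s) := by
    rw [hsq]; field_simp; ring
  rw [e1, Real.sqrt_div h1v.le, Real.sqrt_div hvs.le, Real.sqrt_mul hvs.le]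
  have e2 := Real.sq_sqrt h1s.le
  have p1 := Real.sqrt_pos.2 h1s
  have p2 := Real.sqrt_pos.2 hvs
  have p3 := Real.sqrt_pos.2 h1v
  have hpi := Real.pi_pos
  field_simp
  rw [e2]

lemma lintegral_arcsine {s t : ℝ} (hst : s < t) (ht : t ≤ 1) :
    ∫⁻ v in Ioo s t, ENNReal.ofReal (1 / (Real.pi * √((v - s) * (1 - v)))) =
      ENNReal.ofReal (2 / Real.pi * Real.arcsin √((t - s) / (1 - s))) := by
  have hcont : ContinuousOn (fun v => 2 / Real.pi * Real.arcsin √((v - s) / (1 - s))) (Icc s t) :=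
    by have := Real.continuous_arcsin; fun_prop
  have hderiv : ∀ v ∈ Ioo s t, HasDerivAt (fun v => 2 / Real.pi * Real.arcsin √((v - s) / (1 - s)))
      (1 / (Real.pi * √((v - s) * (1 - v)))) v := fun v hv =>
    hasDerivAt_arcsin_sqrt hv.1 (hv.2.trans_le ht)
  have hnn : ∀ v, 0 ≤ 1 / (Real.pi * √((v - s) * (1 - v))) := fun v => by positivity
  -- The density is singular at s, and at 1 when t = 1; integrability follows from its being the
  -- nonnegative derivative of a continuous function.
  have hint := intervalIntegral.integrableOn_deriv_of_nonneg hcont hderiv fun v _ => hnn v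
  rw [← ofReal_integral_eq_lintegral_ofReal (hint.mono_set Ioo_subset_Ioc_self)
    (ae_of_all _ hnn), ← integral_Ioc_eq_integral_Ioo,
    ← intervalIntegral.integral_of_le hst.le,
    intervalIntegral.integral_eq_sub_of_hasDerivAt_of_le hst.le hcont hderiv
      ((intervalIntegrable_iff_integrableOn_Ioc_of_le hst.le).2 hint)]
  simp

lemma setLIntegral_arcsineKernel {s t : ℝ} (hs : 0 ≤ s) (ht : t ≤ 1) :
    ∫⁻ v in Ioo 0 t, arcsineKernel s v =
      if s < t then ENNReal.ofReal (2 / Real.pi * Real.arcsin √((t - s) / (1 - s))) else 0 := by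
  have h : ∀ v, arcsineKernel s v = (Ioi s).indicator
      (fun v => ENNReal.ofReal (1 / (Real.pi * √((v - s) * (1 - v))))) v := fun v => by
    simp [arcsineKernel, indicator_apply]
  simp_rw [h]
  rw [setLIntegral_indicator measurableSet_Ioi]
  have hset : Ioi s ∩ Ioo 0 t = Ioo s t := by
    ext v; simp only [mem_inter_iff, mem_Ioi, mem_Ioo]
    exact ⟨fun h => ⟨h.1, h.2.2⟩, fun h => ⟨h.1, hs.trans_lt h.1, h.2⟩⟩
  rw [hset]
  split_ifs with hst
  · exact lintegral_arcsine hst ht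
  · simp [Ioo_eq_empty hst]

lemma arctan_div_sqrt_eq_arcsin {s t : ℝ} (hst : s < t) (ht : t < 1) :
    Real.arctan (√(t - s) / √(1 - t)) = Real.arcsin √((t - s) / (1 - s)) := by
  have h1 : 0 < t - s := by linarith
  have h2 : 0 < 1 - t := by linarith
  have h3 : 0 < 1 - s := by linarith
  rw [Real.arctan_eq_arcsin, ← Real.sqrt_div h1.le, Real.sq_sqrt (by positivity),
    ← Real.sqrt_div (by positivity)]
  congr 2
  have : 1 + (t - s) / (1 - t) = (1 - s) / (1 - t) := by field_simp; ring
  rw [this]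
  field_simp

/-- The law of the last jump time before `1` of a Poisson process of intensity `r`. -/
noncomputable def lastResetLaw (r : ℝ) : Measure ℝ :=
  ENNReal.ofReal (Real.exp (-r)) • Measure.dirac 0 +
    (volume.restrict (Ioo (0 : ℝ) 1)).withDensity
      (fun s => ENNReal.ofReal (r * Real.exp (-(r * (1 - s)))))

instance (r : ℝ) : SFinite (lastResetLaw r) := by unfold lastResetLaw; infer_instance

lemma setLIntegral_exp {r : ℝ} (hr : 0 < r) {c : ℝ} (hc : 0 ≤ c) :
    ∫⁻ s in Ioo 0 c, ENNReal.ofReal (r * Real.exp (-(r * (1 - s)))) =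
      ENNReal.ofReal (Real.exp (-(r * (1 - c))) - Real.exp (-r)) := by
  have hcont : Continuous fun s => r * Real.exp (-(r * (1 - s))) := by fun_prop
  rw [← ofReal_integral_eq_lintegral_ofReal
    (hcont.integrableOn_Ioc.mono_set Ioo_subset_Ioc_self)
    (ae_of_all _ fun s => by positivity), ← integral_Ioc_eq_integral_Ioo,
    ← intervalIntegral.integral_of_le hc,
    intervalIntegral.integral_eq_sub_of_hasDerivAt (f := fun s => Real.exp (-(r * (1 - s))))
      (fun s _ => ?_) (hcont.intervalIntegrable _ _)]
  · simp
  · have h : HasDerivAt (fun s => -(r * (1 - s))) r s := by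
      simpa using (((hasDerivAt_id' s).const_sub 1).const_mul r).fun_neg
    simpa [mul_comm] using h.exp

lemma lastResetLaw_Iic {r : ℝ} (hr : 0 < r) (a : ℝ) :
    lastResetLaw r (Iic a) =
      if a < 0 then 0 else ENNReal.ofReal (Real.exp (-(r * (1 - min a 1)))) := by
  rw [lastResetLaw, Measure.add_apply, Measure.smul_apply, withDensity_apply _ measurableSet_Iic,
    Measure.restrict_restrict measurableSet_Iic, Measure.dirac_apply' _ measurableSet_Iic]
  split_ifs with ha
  · have : Iic a ∩ Ioo 0 1 = ∅ := by
      ext s; simp only [mem_inter_iff, mem_Iic, mem_Ioo, mem_empty_iff_false, iff_false]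
      intro h; linarith [h.1, h.2.1]
    rw [this, indicator_of_notMem (by simpa using ha)]
    simp
  · have ha := not_lt.1 ha
    have hae : (Iic a ∩ Ioo (0 : ℝ) 1 : Set ℝ) =ᵐ[volume] Ioo 0 (min a 1) := by
      have : Ioo 0 (min a 1) = Iio a ∩ Ioo (0 : ℝ) 1 := by
        ext s; simp only [mem_inter_iff, mem_Iio, mem_Ioo, lt_min_iff]; tauto
      rw [this]
      exact Iio_ae_eq_Iic.symm.inter (ae_eq_refl _)
    rw [setLIntegral_congr hae, setLIntegral_exp hr (le_min ha zero_le_one),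
      indicator_of_mem (by simpa using ha), Pi.one_apply, smul_eq_mul, mul_one,
      ← ENNReal.ofReal_add (Real.exp_nonneg _) (sub_nonneg.2 (Real.exp_le_exp.2 ?_))]
    · ring_nf
    · nlinarith [le_min ha zero_le_one]

lemma lowerGamma_half_eq {r : ℝ} (hr : 0 < r) {v : ℝ} (hv : 0 < v) (hv1 : v < 1) :
    ∫⁻ s in Ioo 0 v, ENNReal.ofReal (r * Real.exp (-(r * (1 - s)))) *
      ENNReal.ofReal (1 / (Real.pi * √((v - s) * (1 - v)))) =
    ENNReal.ofReal (√r * Real.exp (r * (v - 1)) * lowerGamma (1 / 2) (r * v) /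
      (Real.pi * √(1 - v))) := by
  set f : ℝ → ℝ := fun u => u ^ ((1 / 2 : ℝ) - 1) * Real.exp (-u) with hf
  -- The substitution is u = r(v - s): √r comes from 1/√(v - s) = √r · u^{-1/2}, and the factor r is
  -- cancelled by ds = du/r.
  set C : ℝ := r * √r * Real.exp (r * (v - 1)) / (Real.pi * √(1 - v)) with hC
  have h1v : 0 < 1 - v := by linarith
  have hpt : ∀ s ∈ Ioo 0 v, ENNReal.ofReal (r * Real.exp (-(r * (1 - s)))) *
      ENNReal.ofReal (1 / (Real.pi * √((v - s) * (1 - v)))) =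
      ENNReal.ofReal (C * f (r * v - r * s)) := fun s hs => by
    have hvs : 0 < v - s := by linarith [hs.2]
    rw [← ENNReal.ofReal_mul (by positivity)]
    congr 1
    have e1 : (r * v - r * s) ^ ((1 / 2 : ℝ) - 1) = (√r * √(v - s))⁻¹ := by
      rw [← mul_sub, ← Real.sqrt_mul hr.le, Real.sqrt_eq_rpow, ← Real.rpow_neg (by positivity)]
      norm_num
    have e2 : Real.exp (-(r * (1 - s))) =
        Real.exp (r * (v - 1)) * Real.exp (-(r * v - r * s)) := by
      rw [← Real.exp_add]; ring_nf
    simp only [hf, hC, e1, e2]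
    rw [Real.sqrt_mul hvs.le]
    have p1 := Real.sqrt_pos.2 hr
    have p2 := Real.sqrt_pos.2 hvs
    have p3 := Real.sqrt_pos.2 h1v
    have hpi := Real.pi_pos
    field_simp
  rw [setLIntegral_congr_fun measurableSet_Ioo hpt]
  have hfi : IntervalIntegrable f volume 0 (r * v) := by
    rw [intervalIntegrable_iff_integrableOn_Ioc_of_le (by positivity)]
    refine IntegrableOn.congr_fun ((Real.GammaIntegral_convergent (s := 1 / 2)
      (by norm_num)).mono_set Ioc_subset_Ioi_self) (fun _ _ => mul_comm _ _) measurableSet_Ioc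
  have hfi2 : IntervalIntegrable (fun s => f (r * v - r * s)) volume 0 v := by
    have := ((hfi.comp_sub_left (r * v)).comp_mul_left (c := r)).symm
    simpa [mul_div_cancel_left₀ _ hr.ne'] using this
  have hnn : ∀ s ∈ Ioo 0 v, 0 ≤ C * f (r * v - r * s) := fun s hs => by
    have : 0 ≤ r * v - r * s := by rw [← mul_sub]; have := hs.2; nlinarith
    simp only [hf, hC]
    positivity
  rw [← ofReal_integral_eq_lintegral_ofReal, ← integral_Ioc_eq_integral_Ioo,
    ← intervalIntegral.integral_of_le hv.le, intervalIntegral.integral_const_mul,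
    intervalIntegral.integral_comp_sub_mul f hr.ne']
  · simp only [mul_zero, sub_zero, sub_self, smul_eq_mul]
    congr 1
    simp only [hC, lowerGamma, hf]
    field_simp
  · exact (((intervalIntegrable_iff_integrableOn_Ioc_of_le hv.le).1 hfi2).mono_set
      Ioo_subset_Ioc_self).const_mul C
  · exact (ae_restrict_iff' measurableSet_Ioo).2 (ae_of_all _ hnn)

lemma lowerGamma_nonneg (s : ℝ) {x : ℝ} (hx : 0 ≤ x) : 0 ≤ lowerGamma s x :=
  intervalIntegral.integral_nonneg hx fun _ hu =>
    mul_nonneg (Real.rpow_nonneg hu.1 _) (Real.exp_nonneg _)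

lemma lintegral_arcsineKernel_lastResetLaw {r : ℝ} (hr : 0 < r) {v : ℝ} (hv : 0 < v)
    (hv1 : v < 1) :
    ∫⁻ s, arcsineKernel s v ∂lastResetLaw r = ENNReal.ofReal (lastZeroPDF r v) := by
  have hm : Measurable fun s => arcsineKernel s v :=
    measurable_arcsineKernel.comp (by fun_prop : Measurable fun s : ℝ => (s, v))
  rw [lastResetLaw, lintegral_add_measure, lintegral_smul_measure, lintegral_dirac' _ hm,
    lintegral_withDensity_eq_lintegral_mul _ (by fun_prop) hm]
  have h : ∀ s, ((fun s => ENNReal.ofReal (r * Real.exp (-(r * (1 - s))))) *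
      fun s => arcsineKernel s v) s = (Iio v).indicator (fun s =>
        ENNReal.ofReal (r * Real.exp (-(r * (1 - s)))) *
      ENNReal.ofReal (1 / (Real.pi * √((v - s) * (1 - v))))) s := fun s => by
    by_cases hs : s < v <;> simp [arcsineKernel, hs]
  simp_rw [h]
  rw [setLIntegral_indicator measurableSet_Iio]
  have hset : Iio v ∩ Ioo 0 1 = Ioo 0 v := by
    ext s; simp only [mem_inter_iff, mem_Iio, mem_Ioo]
    exact ⟨fun h => ⟨h.2.1, h.1⟩, fun h => ⟨h.2, h.1, h.2.trans hv1⟩⟩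
  rw [hset, lowerGamma_half_eq hr hv hv1, arcsineKernel, if_pos hv, smul_eq_mul,
    ← ENNReal.ofReal_mul (Real.exp_nonneg _), ← ENNReal.ofReal_add, lastZeroPDF]
  · simp only [sub_zero, mul_one_div]
  · positivity
  · have := lowerGamma_nonneg (1 / 2) (mul_nonneg hr.le hv.le)
    positivity

/-- The density is the arcsine kernel averaged over the reset time; Tonelli lets the integral over v
< t be done first. -/
lemma lawOfDensity_lastZeroPDF_Iio {r : ℝ} (hr : 0 < r) {t : ℝ} (ht : t ≤ 1) :
    lawOfDensity (lastZeroPDF r) (Iio t) =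
      ∫⁻ s, (if s < t then ENNReal.ofReal (2 / Real.pi * Real.arcsin √((t - s) / (1 - s))) else 0)
        ∂lastResetLaw r := by
  have hset : Iio t ∩ Ioo 0 1 = Ioo 0 t := by
    ext s; simp only [mem_inter_iff, mem_Iio, mem_Ioo]
    exact ⟨fun h => ⟨h.2.1, h.1⟩, fun h => ⟨h.2, h.1, h.2.trans_le ht⟩⟩
  have hnonneg : ∀ᵐ s ∂lastResetLaw r, 0 ≤ s := by
    have : {s : ℝ | ¬ 0 ≤ s} = Iio 0 := by ext; simp
    rw [ae_iff, this, ← iUnion_Iic_eq_Iio_of_lt_of_tendsto (a := 0)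
      (F := atTop) (f := fun n : ℕ => -(1 / ((n : ℝ) + 1)))
      (fun n => neg_neg_of_pos (by positivity))
      (by simpa using (tendsto_one_div_add_atTop_nhds_zero_nat (𝕜 := ℝ)).neg)]
    refine measure_iUnion_null fun n => ?_
    rw [lastResetLaw_Iic hr, if_pos (neg_neg_of_pos (by positivity))]
  rw [lawOfDensity, withDensity_apply _ measurableSet_Iio,
    Measure.restrict_restrict measurableSet_Iio, hset,
    setLIntegral_congr_fun measurableSet_Ioo fun v hv =>
      (lintegral_arcsineKernel_lastResetLaw hr hv.1 (hv.2.trans_le ht)).symm,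
    ← lintegral_lintegral_swap measurable_arcsineKernel.aemeasurable]
  refine lintegral_congr_ae ?_
  filter_upwards [hnonneg] with s hs
  exact setLIntegral_arcsineKernel hs ht

/-! ### Total masses and the mixture. -/

lemma lastResetLaw_univ {r : ℝ} (hr : 0 < r) : lastResetLaw r univ = 1 := by
  rw [lastResetLaw, Measure.add_apply, Measure.smul_apply, withDensity_apply _ MeasurableSet.univ,
    Measure.restrict_univ, setLIntegral_exp hr zero_le_one, measure_univ, smul_eq_mul, mul_one,
    ← ENNReal.ofReal_add (Real.exp_nonneg _)]
  · simp
  · simpa using hr.le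

/-- At t = 1 the arcsine is π/2 for every s < 1, so the total mass is that of `lastResetLaw`. -/
lemma isProbabilityMeasure_lawOfDensity_lastZeroPDF {r : ℝ} (hr : 0 < r) :
    IsProbabilityMeasure (lawOfDensity (lastZeroPDF r)) := by
  constructor
  have h1 : lawOfDensity (lastZeroPDF r) univ = lawOfDensity (lastZeroPDF r) (Iio 1) := by
    rw [lawOfDensity, withDensity_apply _ measurableSet_Iio,
      withDensity_apply _ MeasurableSet.univ, Measure.restrict_univ,
      Measure.restrict_restrict measurableSet_Iio, inter_eq_right.2 fun s hs => hs.2]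
  have hlt : ∀ᵐ s ∂lastResetLaw r, s < 1 := by
    rw [lastResetLaw, ae_add_measure_iff]
    refine ⟨Measure.ae_smul_measure ?_ _, ?_⟩
    · rw [ae_dirac_iff measurableSet_Iio]; exact zero_lt_one
    · refine (withDensity_absolutelyContinuous _ _).ae_le ?_
      filter_upwards [ae_restrict_mem measurableSet_Ioo] with s hs using hs.2
  rw [h1, lawOfDensity_lastZeroPDF_Iio hr le_rfl, ← lastResetLaw_univ hr, ← lintegral_one]
  refine lintegral_congr_ae ?_
  filter_upwards [hlt] with s hs
  rw [if_pos hs, div_self (sub_pos.2 hs).ne', Real.sqrt_one, Real.arcsin_one]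
  have := Real.pi_pos
  rw [show 2 / Real.pi * (Real.pi / 2) = 1 by field_simp, ENNReal.ofReal_one]

lemma isProbabilityMeasure_lawOfDensity_arcsinePDF :
    IsProbabilityMeasure (lawOfDensity arcsinePDF) := by
  constructor
  rw [lawOfDensity, withDensity_apply _ MeasurableSet.univ, Measure.restrict_univ]
  have := lintegral_arcsine zero_lt_one (le_refl (1 : ℝ))
  simp only [sub_zero, div_one, Real.sqrt_one, Real.arcsin_one] at this
  simp only [arcsinePDF, this]
  have := Real.pi_pos
  rw [show 2 / Real.pi * (Real.pi / 2) = 1 by field_simp, ENNReal.ofReal_one]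

lemma arcsinePDF_nonneg (t : ℝ) : 0 ≤ arcsinePDF t := by
  unfold arcsinePDF; positivity

lemma resetPDF_nonneg {r : ℝ} (hr : 0 < r) {t : ℝ} (ht : 0 ≤ t) : 0 ≤ resetPDF r t := by
  have h1 := lowerGamma_nonneg (1 / 2) (mul_nonneg hr.le ht)
  have h2 : 0 < Real.exp r - 1 := by simpa using hr
  unfold resetPDF
  positivity

lemma lastZeroPDF_eq_mixture {r : ℝ} (hr : 0 < r) {t : ℝ} (ht : t < 1) :
    lastZeroPDF r t = Real.exp (-r) * arcsinePDF t + (1 - Real.exp (-r)) * resetPDF r t := by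
  have h2 : 0 < Real.exp r - 1 := by simpa using hr
  have h3 := Real.sqrt_pos.2 (sub_pos.2 ht)
  have hpi := Real.pi_pos
  have he := Real.exp_pos r
  rw [lastZeroPDF, arcsinePDF, resetPDF, mul_one_div,
    show r * (t - 1) = r * t - r by ring, Real.exp_sub, Real.exp_neg]
  congr 1
  field_simp

lemma lawOfDensity_lastZeroPDF_eq_mixture {r : ℝ} (hr : 0 < r) :
    lawOfDensity (lastZeroPDF r) =
      ENNReal.ofReal (Real.exp (-r)) • lawOfDensity arcsinePDF +
        ENNReal.ofReal (1 - Real.exp (-r)) • lawOfDensity (resetPDF r) := by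
  have hm : Measurable fun t => ENNReal.ofReal (arcsinePDF t) := by
    unfold arcsinePDF; fun_prop
  have h1 : 0 ≤ 1 - Real.exp (-r) := by simpa using hr.le
  unfold lawOfDensity
  rw [← withDensity_smul _ hm, ← withDensity_smul' _ _ ENNReal.ofReal_ne_top,
    ← withDensity_add_left (hm.const_smul _)]
  refine withDensity_congr_ae ?_
  filter_upwards [ae_restrict_mem measurableSet_Ioo] with t ht
  rw [lastZeroPDF_eq_mixture hr ht.2, ENNReal.ofReal_add
    (mul_nonneg (Real.exp_nonneg _) (arcsinePDF_nonneg t))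
    (mul_nonneg h1 (resetPDF_nonneg hr ht.1.le)), ENNReal.ofReal_mul (Real.exp_nonneg _),
    ENNReal.ofReal_mul h1]
  rfl

/-- No integration is needed: the mixture and its arcsine component have mass 1, and the weight 1 -
e^{-r} is nonzero. -/
lemma isProbabilityMeasure_lawOfDensity_resetPDF {r : ℝ} (hr : 0 < r) :
    IsProbabilityMeasure (lawOfDensity (resetPDF r)) := by
  constructor
  have hp := isProbabilityMeasure_lawOfDensity_lastZeroPDF hr
  have ha := isProbabilityMeasure_lawOfDensity_arcsinePDF
  have h := hp.measure_univ
  have hlt : Real.exp (-r) < 1 := by simpa using hr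
  rw [lawOfDensity_lastZeroPDF_eq_mixture hr, Measure.add_apply, Measure.smul_apply,
    Measure.smul_apply, ha.measure_univ, smul_eq_mul, smul_eq_mul, mul_one] at h
  have h1 : (1 : ℝ≥0∞) = ENNReal.ofReal (Real.exp (-r)) + ENNReal.ofReal (1 - Real.exp (-r)) := by
    rw [← ENNReal.ofReal_add (Real.exp_nonneg _) (by linarith)]; simp
  rw [h1, ENNReal.add_right_inj ENNReal.ofReal_ne_top] at h
  have h0 : ENNReal.ofReal (1 - Real.exp (-r)) ≠ 0 := by
    simpa [ENNReal.ofReal_eq_zero] using hlt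
  exact (ENNReal.mul_right_inj h0 ENNReal.ofReal_ne_top).1 (by rwa [mul_one])

end Densities


/-! ### The law of the last zero -/

section Law

variable {Ω : Type*} [MeasurableSpace Ω] {P : Measure Ω}

lemma IsPoissonProcess.measure_apply_eq {N : ℝ≥0 → Ω → ℕ} {r : ℝ≥0} (hN : IsPoissonProcess N r P)
    {s t : ℝ≥0} (hst : s ≤ t) :
    P {ω | N s ω = N t ω} = ENNReal.ofReal (Real.exp (-(r * (t - s) : ℝ))) := by
  have h1 := (hN.stationary s (t - s)).measure_mem_eq (s := {0}) (measurableSet_singleton _)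
  rw [add_tsub_cancel_of_le hst] at h1
  have e1 : {ω | N s ω = N t ω} =
      (fun ω => (N t ω : ℤ) - (N s ω : ℤ)) ⁻¹' {0} := by
    ext ω
    simp only [mem_ofPred_eq, mem_preimage, mem_singleton_iff]
    omega
  have e2 : P ((fun ω => (N (t - s) ω : ℤ) - (N 0 ω : ℤ)) ⁻¹' {0}) =
      P {ω | N (t - s) ω ∈ ({0} : Set ℕ)} := by
    refine measure_congr ?_
    filter_upwards [hN.zero] with ω hω
    refine propext ?_
    change (N (t - s) ω : ℤ) - (N 0 ω : ℤ) ∈ ({0} : Set ℤ) ↔ N (t - s) ω ∈ ({0} : Set ℕ)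
    simp [hω]
  rw [e1, h1, e2, (hN.law (t - s)).measure_eq (p := fun k => k ∈ ({0} : Set ℕ))
    (measurableSet_singleton 0)]
  change poissonMeasure _ {0} = _
  rw [poissonMeasure_singleton]
  simp [NNReal.coe_sub hst]

/-- For a ≥ 0, the last reset is at most a iff N takes the same value at min a 1 and at 1, an event
of probability e^{-r(1 - min a 1)}. -/
lemma hasLaw_lastReset [IsProbabilityMeasure P] {N : ℝ≥0 → Ω → ℕ} {r : ℝ≥0} (hr : 0 < r)
    (hN : IsPoissonProcess N r P) (hm : AEMeasurable (fun ω => lastReset fun t => N t ω) P) :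
    HasLaw (fun ω => (lastReset (fun t => N t ω) : ℝ)) (lastResetLaw r) P := by
  have hm' : AEMeasurable (fun ω => (lastReset (fun t => N t ω) : ℝ)) P :=
    measurable_coe_nnreal_real.comp_aemeasurable hm
  refine ⟨hm', ?_⟩
  have := Measure.isProbabilityMeasure_map (μ := P) hm'
  refine Measure.ext_of_Iic _ _ fun a => ?_
  rw [lastResetLaw_Iic (by exact_mod_cast hr), Measure.map_apply_of_aemeasurable hm'
    measurableSet_Iic]
  split_ifs with ha
  · have : (fun ω => (lastReset (fun t => N t ω) : ℝ)) ⁻¹' Iic a = ∅ := by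
      ext ω
      simp only [mem_preimage, mem_Iic, mem_empty_iff_false, iff_false, not_le]
      exact ha.trans_le (NNReal.coe_nonneg _)
    rw [this, measure_empty]
  · lift a to ℝ≥0 using not_lt.1 ha
    have h := hN.measure_apply_eq (min_le_right a 1)
    push_cast at h
    rw [← h]
    refine measure_congr ?_
    filter_upwards [hN.monotone, hN.rightCont] with ω h1 h2
    refine propext ?_
    change (lastReset (fun t => N t ω) : ℝ) ≤ a ↔ N (min a 1) ω = N 1 ω
    rw [NNReal.coe_le_coe, lastReset_eq_jumpTime h1 h2,
      ← jumpTime_le_iff (n := fun t => N t ω) h1 h2 (min_le_right a 1), le_min_iff,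
      and_iff_left (jumpTime_le (fun t => N t ω) 1)]

lemma Iio_one_eq_iUnion : Iio (1 : ℝ) = ⋃ n : ℕ, Iio (1 - 1 / ((n : ℝ) + 2)) := by
  ext x
  simp only [mem_Iio, mem_iUnion]
  refine ⟨fun hx => ?_, fun ⟨n, hn⟩ => hn.trans (sub_lt_self _ (by positivity))⟩
  obtain ⟨n, hn⟩ := exists_nat_one_div_lt (sub_pos.2 hx)
  have : 1 / ((n : ℝ) + 2) ≤ 1 / ((n : ℝ) + 1) := by gcongr; norm_num
  exact ⟨n, by linarith⟩

/-- Measurability of f is deduced rather than assumed: null measurability of the half-line preimages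
suffices. Levels outside (0, 1) follow from the bounds on f and the support of ν, with continuity
from below at 1. -/
lemma hasLaw_of_measure_Iio [IsProbabilityMeasure P] {f : Ω → ℝ} (h0 : ∀ ω, 0 ≤ f ω)
    (h1 : ∀ ω, f ω ≤ 1) {ν : Measure ℝ} [IsProbabilityMeasure ν] (hν : ν (Ioo 0 1)ᶜ = 0)
    (hf : ∀ t, 0 < t → t < 1 → NullMeasurableSet (f ⁻¹' Iio t) P ∧ P (f ⁻¹' Iio t) = ν (Iio t)) :
    HasLaw f ν P := by
  -- The shift by 2 keeps t 0 = 1/2 inside (0, 1).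
  set t : ℕ → ℝ := fun n => 1 - 1 / ((n : ℝ) + 2) with ht
  have ht01 : ∀ n, 0 < t n ∧ t n < 1 := fun n => by
    have : 1 / ((n : ℝ) + 2) < 1 := by
      rw [div_lt_one (by positivity)]
      linarith [(Nat.cast_nonneg n : (0 : ℝ) ≤ n)]
    exact ⟨by simp only [ht]; linarith, sub_lt_self _ (by positivity)⟩
  have hmono : Monotone t := fun m n h => by simp only [ht]; gcongr
  have key : ∀ x, NullMeasurableSet (f ⁻¹' Iio x) P ∧ P (f ⁻¹' Iio x) = ν (Iio x) := fun x => by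
    rcases le_or_gt x 0 with hx | hx
    · have : f ⁻¹' Iio x = ∅ := by
        ext ω
        simpa using hx.trans (h0 ω)
      rw [this, measure_empty]
      refine ⟨nullMeasurableSet_empty, (measure_mono_null ?_ hν).symm⟩
      exact fun y hy hy' => absurd (hy'.1.trans hy) (not_lt.2 hx)
    rcases lt_trichotomy x 1 with hx1 | rfl | hx1
    · exact hf x hx hx1
    · rw [Iio_one_eq_iUnion, preimage_iUnion]
      refine ⟨NullMeasurableSet.iUnion fun n => (hf (t n) (ht01 n).1 (ht01 n).2).1, ?_⟩
      rw [Monotone.measure_iUnion fun m n h => preimage_mono (Iio_subset_Iio (hmono h)),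
        Monotone.measure_iUnion fun m n h => Iio_subset_Iio (hmono h)]
      exact iSup_congr fun n => (hf (t n) (ht01 n).1 (ht01 n).2).2
    · have : f ⁻¹' Iio x = univ := by
        ext ω
        simpa using (h1 ω).trans_lt hx1
      rw [this, measure_univ]
      refine ⟨nullMeasurableSet_univ, ((prob_compl_eq_zero_iff measurableSet_Iio).1
        (measure_mono_null ?_ hν)).symm⟩
      exact fun y hy hy' => hy (hy'.2.trans hx1)
  have hm : AEMeasurable f P := by
    refine NullMeasurable.aemeasurable ?_
    exact measurable_of_Iio (δ := NullMeasurableSpace Ω P) fun x => (key x).1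
  refine ⟨hm, ?_⟩
  have := Measure.isProbabilityMeasure_map (μ := P) hm
  refine Measure.ext_of_Ici _ _ fun x => ?_
  rw [← compl_Iio, prob_compl_eq_one_sub measurableSet_Iio, prob_compl_eq_one_sub measurableSet_Iio,
    Measure.map_apply_of_aemeasurable hm measurableSet_Iio, (key x).2]

lemma lawOfDensity_compl_Ioo (p : ℝ → ℝ) : lawOfDensity p (Ioo 0 1)ᶜ = 0 := by
  rw [lawOfDensity, withDensity_apply _ measurableSet_Ioo.compl,
    Measure.restrict_restrict measurableSet_Ioo.compl, compl_inter_self]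
  simp

lemma lastZero_nonneg (x : ℝ≥0 → ℝ) : 0 ≤ lastZero x := NNReal.coe_nonneg _

lemma lastZero_le_one (x : ℝ≥0 → ℝ) : lastZero x ≤ 1 := by
  rw [lastZero, ← NNReal.coe_one, NNReal.coe_le_coe]
  exact csSup_le' fun _ h => h.1

/-- The pairs of a time `s < t` and the restriction `b` of a continuous path to a dense sequence
of times such that the path does not return on `[t, 1]` to its value at time `s`. -/
def noReturnSet (t : ℝ≥0) : Set (ℝ≥0 × (ℕ → ℝ)) :=
  {p | p.1 < t} ∩ (⋂ m : ℕ, ⋃ i : {i // TopologicalSpace.denseSeq ℝ≥0 i ∈ Icc t 1}, ⋃ j : ℕ,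
    {p | dist (TopologicalSpace.denseSeq ℝ≥0 j) p.1 < 1 / ((m : ℝ) + 1)} ∩
      {p | |p.2 i - p.2 j| < 1 / ((m : ℝ) + 1)})ᶜ

lemma measurableSet_noReturnSet (t : ℝ≥0) : MeasurableSet (noReturnSet t) := by
  refine (measurableSet_lt (by fun_prop) (by fun_prop)).inter (MeasurableSet.compl ?_)
  refine MeasurableSet.iInter fun m => MeasurableSet.iUnion fun i => MeasurableSet.iUnion fun j => ?_
  exact (measurableSet_lt (by fun_prop) (by fun_prop)).inter
    (measurableSet_lt (by fun_prop) (by fun_prop))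

lemma mem_noReturnSet_iff {b : ℝ≥0 → ℝ} (hb : Continuous b) {t : ℝ≥0} (ht : t < 1) (s : ℝ≥0) :
    (s, fun i => b (TopologicalSpace.denseSeq ℝ≥0 i)) ∈ noReturnSet t ↔
      s < t ∧ ¬ ∃ u ∈ Icc t 1, b u = b s := by
  rw [exists_apply_eq_apply_iff_dense hb (TopologicalSpace.denseRange_denseSeq ℝ≥0) ht s]
  simp [noReturnSet]

/-- The event is expressed through the reset time T and the values β of B on a dense sequence. Their
joint law is a product measure, so its probability is an integral over sections with T frozen at s.
-/
theorem hasLaw_lastZero [IsProbabilityMeasure P] {r : ℝ≥0} (hr : 0 < r) {X : ℝ≥0 → Ω → ℝ}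
    (hX : IsResetBrownian X r P) :
    HasLaw (fun ω => lastZero fun t => X t ω) (lawOfDensity (lastZeroPDF r)) P := by
  obtain ⟨B, N, hB, hN, hBN, hXBN⟩ := hX
  have hr' : (0 : ℝ) < r := by exact_mod_cast hr
  have := isProbabilityMeasure_lawOfDensity_lastZeroPDF hr'
  set q := TopologicalSpace.denseSeq ℝ≥0 with hq
  set T : Ω → ℝ≥0 := fun ω => lastReset fun t => N t ω with hT
  set β : Ω → ℕ → ℝ := fun ω i => B (q i) ω with hβ
  have hβm : AEMeasurable β P := aemeasurable_pi_lambda _ fun i => hB.aemeasurable _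
  have hTm : AEMeasurable T P := by
    refine AEMeasurable.iInf fun i => ?_
    have hg : Measurable fun p : ℕ × ℕ => if p.1 = p.2 then min (q i) 1 else 1 := .of_discrete
    exact hg.comp_aemeasurable ((hN.law (q i)).aemeasurable.prodMk (hN.law 1).aemeasurable)
  -- Independence holds for the path σ-algebras, so T must be a measurable function of the whole
  -- path of N; `lastReset` provides one.
  have hind : IndepFun T β P :=
    (hBN.comp (φ := fun (b : ℝ≥0 → ℝ) i => b (q i)) (ψ := lastReset)
      (measurable_pi_lambda _ fun _ => measurable_pi_apply _) measurable_lastReset).symm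
  have hmap := (indepFun_iff_map_prod_eq_prod_map_map hTm hβm).1 hind
  have hTlaw := hasLaw_lastReset hr hN hTm
  refine hasLaw_of_measure_Iio (fun ω => lastZero_nonneg _) (fun ω => lastZero_le_one _)
    (lawOfDensity_compl_Ioo _) fun t ht0 ht1 => ?_
  lift t to ℝ≥0 using ht0.le
  have ht1 : t < 1 := by exact_mod_cast ht1
  have hev : (fun ω => (T ω, β ω)) ⁻¹' noReturnSet t =ᵐ[P]
      (fun ω => lastZero fun t => X t ω) ⁻¹' Iio (t : ℝ) := by
    filter_upwards [hB.cont, hN.monotone, hN.rightCont, hXBN] with ω h1 h2 h3 h4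
    refine propext ?_
    change (T ω, β ω) ∈ noReturnSet t ↔ lastZero (fun t => X t ω) < t
    rw [show (fun t => X t ω) = _ from funext h4, lastZero_resetPath_lt_iff h2 h3 h1,
      ← lastReset_eq_jumpTime h2 h3]
    exact mem_noReturnSet_iff h1 ht1 _
  have hpair : AEMeasurable (fun ω => (T ω, β ω)) P := hTm.prodMk hβm
  refine ⟨(hpair.nullMeasurableSet_preimage (measurableSet_noReturnSet t)).congr hev, ?_⟩
  rw [← measure_congr hev, ← Measure.map_apply_of_aemeasurable hpair (measurableSet_noReturnSet t),
    hmap, Measure.prod_apply (measurableSet_noReturnSet t),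
    lawOfDensity_lastZeroPDF_Iio hr' (by exact_mod_cast ht1.le)]
  have hsec : ∀ s, (P.map β) (Prod.mk s ⁻¹' noReturnSet t) =
      if (s : ℝ) < t then ENNReal.ofReal (2 / Real.pi *
        Real.arcsin √(((t : ℝ) - s) / (1 - s))) else 0 := fun s => by
    rw [Measure.map_apply_of_aemeasurable hβm
      ((measurableSet_noReturnSet t).preimage measurable_prodMk_left)]
    have hae : β ⁻¹' (Prod.mk s ⁻¹' noReturnSet t) =ᵐ[P]
        {ω | s < t ∧ ¬ ∃ u ∈ Icc t 1, B u ω = B s ω} := by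
      filter_upwards [hB.cont] with ω h
      exact propext (mem_noReturnSet_iff h ht1 s)
    rw [measure_congr hae]
    split_ifs with hst
    · have hst' : s < t := by exact_mod_cast hst
      simp only [hst', true_and]
      rw [measure_not_exists_return hB hst' ht1, NNReal.coe_one,
        arctan_div_sqrt_eq_arcsin hst (by exact_mod_cast ht1)]
    · have hst' : ¬ s < t := by exact_mod_cast hst
      simp [hst']
  simp_rw [hsec]
  have hmeas : Measurable fun s : ℝ => if s < t then ENNReal.ofReal (2 / Real.pi *
      Real.arcsin √(((t : ℝ) - s) / (1 - s))) else 0 := by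
    have := Real.measurable_arcsin
    exact Measurable.ite measurableSet_Iio (by fun_prop) measurable_const
  refine (lintegral_map' (hmeas.comp measurable_coe_nnreal_real).aemeasurable hTm).trans ?_
  exact hTlaw.lintegral_comp hmeas.aemeasurable

end Law

end ResetBM

theorem mainTheorem4 {Ω : Type*} [MeasurableSpace Ω] (P : Measure Ω) [IsProbabilityMeasure P]
    (r : ℝ≥0) (hr : 0 < r) (X : ℝ≥0 → Ω → ℝ) (hX : ResetBM.IsResetBrownian X r P) :
    -- the last zero has the density `lastZeroPDF r` on `(0,1)`
    HasLaw (fun ω => ResetBM.lastZero (fun t => X t ω))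
      (ResetBM.lawOfDensity (ResetBM.lastZeroPDF r)) P ∧
    -- both components of the mixture are nonnegative probability densities
    (∀ t ∈ Ioo (0 : ℝ) 1, 0 ≤ ResetBM.arcsinePDF t ∧ 0 ≤ ResetBM.resetPDF r t) ∧
    IsProbabilityMeasure (ResetBM.lawOfDensity ResetBM.arcsinePDF) ∧
    IsProbabilityMeasure (ResetBM.lawOfDensity (ResetBM.resetPDF r)) ∧
    -- the density is the mixture with weights `e^{-r}` and `1 - e^{-r}`
    (∀ t ∈ Ioo (0 : ℝ) 1, ResetBM.lastZeroPDF r t =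
      Real.exp (-r) * ResetBM.arcsinePDF t + (1 - Real.exp (-r)) * ResetBM.resetPDF r t) ∧
    -- hence so is the law
    HasLaw (fun ω => ResetBM.lastZero (fun t => X t ω))
      (ENNReal.ofReal (Real.exp (-r)) • ResetBM.lawOfDensity ResetBM.arcsinePDF +
        ENNReal.ofReal (1 - Real.exp (-r)) • ResetBM.lawOfDensity (ResetBM.resetPDF r)) P := by
  have hr' : (0 : ℝ) < r := by exact_mod_cast hr
  have hlaw := ResetBM.hasLaw_lastZero hr hX
  refine ⟨hlaw, fun t ht => ⟨ResetBM.arcsinePDF_nonneg t, ResetBM.resetPDF_nonneg hr' ht.1.le⟩,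
    ResetBM.isProbabilityMeasure_lawOfDensity_arcsinePDF,
    ResetBM.isProbabilityMeasure_lawOfDensity_resetPDF hr',
    fun t ht => ResetBM.lastZeroPDF_eq_mixture hr' ht.2, ?_⟩
  rwa [← ResetBM.lawOfDensity_lastZeroPDF_eq_mixture hr']
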